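/- Let $(\Omega,\mathcal F,\mathbb P)$ be a complete probability space, $\sigma:\Omega\to\Omega$ an invertible (bi-measurable), measure preserving, ergodic transformation, $R>0$, and $c:\Omega\to\mathbb D(0,R)=\{|z|<R\}$ a measurable map (a bounded random system of quadratic maps). Put $f_\omega(z)=z^2+c(\omega)$ and $f^n_\omega=f_{\sigma^{n-1}\omega}\circ\dots\circ f_{\sigma\omega}\circ f_\omega$. For $\omega\in\Omega$ let $\mathcal A_\omega=\{z\in\mathbb C: f^n_\omega(z)\to\infty\}$, let $K_\omega=\mathbb C\setminus\mathcal A_\omega$ be the filled-in Julia set, and let the Julia set $J_\omega$ be the set of points having no open neighbourhood on which $(f^n_\omega)_n$ is a normal family (as maps into the Riemann sphere). Then: 1. $(K_\omega)_{\omega\in\Omega}$ is a random closed set: every $K_\omega$ is closed, and $\omega\mapsto\operatorname{dist}(z,K_\omega)$ is measurable for every $z\in\mathbb C$. 2. For every $\omega\in\Omega$ and $z\in\mathcal A_\omega$ the limit $g_\omega(z)=\lim_{n\to\infty}2^{-n}\ln|f^n_\omega(z)|$ exists. Put $g_\omega=0$ on $K_\omega$. Then $g_\omega$ is the Green function of $\mathcal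 A_\omega$ with pole at infinity: $\mathcal A_\omega$ is an open neighbourhood of infinity, and $g_\omega$ is positive and harmonic on $\mathcal A_\omega$, $g_\omega(z)-\ln|z|$ is bounded near infinity, and $g_\omega(z)\to0$ as $z\in\mathcal A_\omega$ tends to a point of $\partial\mathcal A_\omega$. For every $R_0>0$ the family $(g_\omega)_{\omega\in\Omega}$ is a random continuous function on $\mathbb D_{R_0}=\{|z|<R_0\}$: each $g_\omega$ is continuous and bounded on $\mathbb D_{R_0}$, $\omega\mapsto g_\omega(z)$ is measurable for every $z\in\mathbb D_{R_0}$, and $\omega\mapsto\sup_{\mathbb D_{R_0}}|g_\omega|$ is $\mathbb P$-integrable. 3. For every $\omega\in\Omega$ the function $g_\omega$ is locally integrable on $\mathbb C$, and there is exactly one locally finite Borel measure $\mu_\omega$ on $\mathbb C$ with $\mu_\omega=\frac1{2\pi}\Delta g_\omega$ in the sense of distributions, i.e. $\int\varphi\,d\mu_\omega=\frac1{2\pi}\int_{\mathbb C} g_\omega\,\Delta\varphi\,d\mathrm{Leb}$ for every $\varphi\in C_c^\infty(\mathbb C)$. It is a probability measure with $\mu_\omega(\mathbb C\setminus J_\omega)=0$,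 and $(\mu_\omega)_{\omega\in\Omega}$ is a random probability measure: $\omega\mapsto\mu_\omega(B)$ is measurable for every Borel set $B\subset\mathbb C$, and $\mu_\omega$ is a Borel probability measure for $\mathbb P$-almost every (in fact every) $\omega$. -/

import Mathlib

open MeasureTheory Filter Topology Set

noncomputable section

/-- A bounded random system of quadratic maps over the probability space `(Ω, P)`: an ergodic
measure preserving automorphism `σ`, a constant `R > 0`, and a measurable choice of a parameter
`c ω` in the open disc of radius `R` about `0`. -/
structure BoundedRandomQuadraticSystem {Ω : Type*} [MeasurableSpace Ω] (P : Measure Ω) where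
  σ : Ω ≃ᵐ Ω
  ergodic : Ergodic σ P
  R : ℝ
  R_pos : 0 < R
  c : Ω → ℂ
  measurable_c : Measurable c
  c_mem : ∀ ω, c ω ∈ Metric.ball (0 : ℂ) R

/-- The family `F` is normal on `U`: every sequence of its members has a subsequence that converges
locally uniformly on `U` as maps into the Riemann sphere (so that the limit may take the value `∞`;
the sphere carries the unique uniformity compatible with its compact topology). -/
def IsNormalFamilyOn (F : ℕ → ℂ → ℂ) (U : Set ℂ) : Prop :=
  letI : UniformSpace (OnePoint ℂ) := uniformSpaceOfCompactR1
  ∀ s : ℕ → ℕ, ∃ t : ℕ → ℕ, StrictMono t ∧ ∃ h : ℂ → OnePoint ℂ,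
    TendstoLocallyUniformlyOn (fun k z => ((F (s (t k)) z : ℂ) : OnePoint ℂ)) h atTop U

namespace BoundedRandomQuadraticSystem

variable {Ω : Type*} [MeasurableSpace Ω] {P : Measure Ω} (S : BoundedRandomQuadraticSystem P)

/-- The quadratic map `f_ω (z) = z ^ 2 + c ω`. -/
def map (ω : Ω) (z : ℂ) : ℂ := z ^ 2 + S.c ω

/-- The random iterate `f_ω ^ n = f_{σ ^ (n - 1) ω} ∘ ⋯ ∘ f_{σ ω} ∘ f_ω`. -/
def iter (ω : Ω) : ℕ → ℂ → ℂ
  | 0 => fun z => z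
  | n + 1 => fun z => S.map (S.σ^[n] ω) (iter ω n z)

/-- The escaping set (basin of infinity) `𝒜_ω`. -/
def escapingSet (ω : Ω) : Set ℂ :=
  {z | Tendsto (fun n => S.iter ω n z) atTop (Bornology.cobounded ℂ)}

/-- The filled-in Julia set `K_ω`, the complement of the escaping set. -/
def filledJulia (ω : Ω) : Set ℂ := (S.escapingSet ω)ᶜ

/-- The Julia set `J_ω`: the points with no open neighbourhood on which the iterates form a normal
family. -/
def julia (ω : Ω) : Set ℂ :=
  {z | ∀ U : Set ℂ, IsOpen U → z ∈ U → ¬ IsNormalFamilyOn (S.iter ω) U}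

open Classical in
/-- The Green function: `g_ω (z) = lim 2 ^ (-n) log |f_ω ^ n (z)|` on the escaping set, and `0`
on its complement. -/
def green (ω : Ω) (z : ℂ) : ℝ :=
  if z ∈ S.escapingSet ω then
    limUnder atTop (fun n : ℕ => 1 / 2 ^ n * Real.log ‖S.iter ω n z‖)
  else 0

end BoundedRandomQuadraticSystem

/-- `g` is the Green function with pole at infinity of the open set `A` (a neighbourhood of
infinity, regular for the Dirichlet problem): it is positive and harmonic on `A`, differs from
`log |z|` by a bounded amount near infinity, and vanishes at the boundary of `A`. -/
structure IsGreenFunctionAtInfinity (A : Set ℂ) (g : ℂ → ℝ) : Prop where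
  isOpen : IsOpen A
  nhds_infty : A ∈ Bornology.cobounded ℂ
  harmonic : InnerProductSpace.HarmonicOnNhd g A
  pos : ∀ z ∈ A, 0 < g z
  log_pole : (fun z => g z - Real.log ‖z‖) =O[Bornology.cobounded ℂ] (fun _ => (1 : ℝ))
  boundary : ∀ ζ ∈ frontier A, Tendsto g (𝓝[A] ζ) (𝓝 0)

/-- `μ` is the distribution `(1 / 2π) Δ g` on the plane: `μ` is a locally finite Borel measure and
`∫ φ dμ = (1 / 2π) ∫ g Δφ` (Lebesgue measure on the right) for every test function `φ`. -/
structure IsNormalizedLaplacian (g : ℂ → ℝ) (μ : Measure ℂ) : Prop where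
  locallyIntegrable : LocallyIntegrable g volume
  locallyFinite : IsLocallyFiniteMeasure μ
  integral_eq : ∀ φ : ℂ → ℝ, ContDiff ℝ ((⊤ : ℕ∞) : WithTop ℕ∞) φ → HasCompactSupport φ →
    ∫ z, φ z ∂μ = 1 / (2 * Real.pi) * ∫ z, g z * Laplacian.laplacian φ z

/-- Random closed set: every `C ω` is closed and `ω ↦ dist (z, C ω)` is measurable for every `z`
(with the distance to the empty set equal to `∞`). -/
def IsRandomClosedSet {Ω X : Type*} [MeasurableSpace Ω] [PseudoEMetricSpace X]
    (C : Ω → Set X) : Prop :=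
  (∀ ω, IsClosed (C ω)) ∧ ∀ z : X, Measurable (fun ω => Metric.infEDist z (C ω))

/-- Random continuous function: every `φ ω` is continuous and bounded, `ω ↦ φ ω z` is measurable
for every `z`, and `ω ↦ ‖φ ω‖_∞` is integrable. -/
structure IsRandomContinuous {Ω X : Type*} [MeasurableSpace Ω] [TopologicalSpace X]
    (P : Measure Ω) (φ : Ω → X → ℝ) : Prop where
  continuous : ∀ ω, Continuous (φ ω)
  bounded : ∀ ω, ∃ C : ℝ, ∀ z, |φ ω z| ≤ C
  measurable : ∀ z, Measurable (fun ω => φ ω z)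
  integrable_sup : Integrable (fun ω => ⨆ z, |φ ω z|) P

/-- Random probability measure: `ω ↦ μ ω B` is measurable for every Borel set `B`, and `μ ω` is
a probability measure for almost every `ω`. -/
structure IsRandomProbabilityMeasure {Ω X : Type*} [MeasurableSpace Ω] [MeasurableSpace X]
    (P : Measure Ω) (μ : Ω → Measure X) : Prop where
  measurable : ∀ B : Set X, MeasurableSet B → Measurable (fun ω => μ ω B)
  isProbabilityMeasure : ∀ᵐ ω ∂P, IsProbabilityMeasure (μ ω)

end

/-! ### Escape estimates -/

/-! All parameters have modulus below `R`, so the radius `R + 2` is an escape radius for every `ω`: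
an orbit that reaches it at least doubles in modulus from then on. Hence the escaping set is an
increasing union of open conditions on single iterates, and compactness turns "this closed ball
escapes" into a countable condition. This gives the random closed set.

For the Green function, let `N(w) = ½ log(1 + |w|²)`. The defect `N(w² + c) - 2N(w)` is bounded on
all of `ℂ`, uniformly in `|c| < R` (`abs_fubiniPotential_sq_add_sub_le`), so `2⁻ⁿ N(fⁿ)` converges
geometrically and uniformly on the whole plane. The limit is `g_ω`, because `N - log|·|` tends to
`0` along escaping orbits while the other orbits are bounded. Continuity, joint measurability and
bounds independent of `ω` follow. For fixed `c` the defect also tends to `0` at infinity, hence so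
does `g_ω - N`. On the basin, telescoping writes `g_ω` locally as `2⁻ᴺ log|fᴺ|` plus the real part
of a holomorphic series, which is harmonic.

For the measure, `Δ(N ∘ f) = 2|f'|² / (1 + |f|²)² ≥ 0` for entire `f`, so the approximations have
nonnegative Laplacians. By Green's identity these converge on test functions, and Riesz
representation yields `μ_ω`, which its test integrals determine. It does not charge the basin (`g_ω`
is harmonic there) or the interior of `K_ω` (`g_ω = 0` there), and these two sets cover the
complement of `J_ω`. Its mass is `1` because `ΔN` has integral `2π` and `g_ω - N` vanishes at
infinity. Measurability in `ω` passes from `g_ω` to test integrals by Fubini, then to Borel sets by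
a π-system argument. -/

lemma two_mul_norm_le_norm_sq_add {R : ℝ} {w c : ℂ} (hR : 0 < R) (hc : ‖c‖ < R)
    (hw : R + 2 ≤ ‖w‖) : 2 * ‖w‖ ≤ ‖w ^ 2 + c‖ := by
  have h := norm_sub_le_norm_add (w ^ 2) c
  rw [norm_pow] at h
  nlinarith

/-- Quadratic growth, stronger than doubling, is what bounds `2⁻ⁿ log|fⁿ|` away from zero in
`green_pos`. -/
lemma half_norm_sq_le_norm_sq_add {R : ℝ} {w c : ℂ} (hR : 0 < R) (hc : ‖c‖ < R)
    (hw : R + 2 ≤ ‖w‖) : ‖w‖ ^ 2 / 2 ≤ ‖w ^ 2 + c‖ := by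
  have h := norm_sub_le_norm_add (w ^ 2) c
  rw [norm_pow] at h
  nlinarith

namespace BoundedRandomQuadraticSystem

variable {Ω : Type*} [MeasurableSpace Ω] {P : Measure Ω} (S : BoundedRandomQuadraticSystem P)

lemma norm_c_lt (ω : Ω) : ‖S.c ω‖ < S.R := by simpa using S.c_mem ω

@[simp] lemma iter_zero (ω : Ω) (z : ℂ) : S.iter ω 0 z = z := rfl

lemma iter_succ (ω : Ω) (n : ℕ) (z : ℂ) :
    S.iter ω (n + 1) z = S.iter ω n z ^ 2 + S.c (S.σ^[n] ω) := rfl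

lemma differentiable_iter (ω : Ω) (n : ℕ) : Differentiable ℂ (S.iter ω n) := by
  induction n with
  | zero => exact differentiable_id
  | succ n ih => exact (ih.pow 2).add_const _

lemma continuous_iter (ω : Ω) (n : ℕ) : Continuous (S.iter ω n) :=
  (S.differentiable_iter ω n).continuous

lemma measurable_iter (n : ℕ) : Measurable fun p : Ω × ℂ => S.iter p.1 n p.2 := by
  induction n with
  | zero => exact measurable_snd
  | succ n ih =>
    exact (ih.pow_const 2).add
      ((S.measurable_c.comp (S.σ.measurable.iterate n)).comp measurable_fst)

lemma two_pow_mul_le_norm_iter {ω : Ω} {n : ℕ} {z : ℂ} (h : S.R + 2 ≤ ‖S.iter ω n z‖) (k : ℕ) :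
    2 ^ k * ‖S.iter ω n z‖ ≤ ‖S.iter ω (n + k) z‖ := by
  induction k with
  | zero => simp
  | succ k ih =>
    have h1 : (1 : ℝ) ≤ 2 ^ k := one_le_pow₀ (by norm_num)
    have h2 : S.R + 2 ≤ ‖S.iter ω (n + k) z‖ := by nlinarith [S.R_pos]
    have h3 := two_mul_norm_le_norm_sq_add S.R_pos (S.norm_c_lt (S.σ^[n + k] ω)) h2
    rw [← add_assoc, iter_succ, pow_succ]
    linarith

lemma norm_iter_le_norm_iter {ω : Ω} {n m : ℕ} {z : ℂ} (h : S.R + 2 ≤ ‖S.iter ω n z‖)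
    (hm : n ≤ m) : ‖S.iter ω n z‖ ≤ ‖S.iter ω m z‖ := by
  obtain ⟨k, rfl⟩ := Nat.exists_eq_add_of_le hm
  have h1 : (1 : ℝ) ≤ 2 ^ k := one_le_pow₀ (by norm_num)
  nlinarith [S.R_pos, S.two_pow_mul_le_norm_iter h k]

lemma mem_escapingSet_of_le {ω : Ω} {n : ℕ} {z : ℂ} (h : S.R + 2 ≤ ‖S.iter ω n z‖) :
    z ∈ S.escapingSet ω := by
  rw [escapingSet, mem_ofPred_eq, ← tendsto_norm_atTop_iff_cobounded, ← tendsto_add_atTop_iff_nat n]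
  refine tendsto_atTop_mono (fun k => ?_)
    ((tendsto_pow_atTop_atTop_of_one_lt (one_lt_two : (1 : ℝ) < 2)))
  have h1 : (0 : ℝ) < 2 ^ k := by positivity
  rw [add_comm k n]
  nlinarith [S.R_pos, S.two_pow_mul_le_norm_iter h k]

lemma tendsto_norm_iter {ω : Ω} {z : ℂ} (h : z ∈ S.escapingSet ω) :
    Tendsto (fun n => ‖S.iter ω n z‖) atTop atTop :=
  tendsto_norm_atTop_iff_cobounded.2 h

lemma mem_escapingSet_iff {ω : Ω} {z : ℂ} :
    z ∈ S.escapingSet ω ↔ ∃ n, S.R + 2 < ‖S.iter ω n z‖ :=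
  ⟨fun h => ((S.tendsto_norm_iter h).eventually_gt_atTop _).exists,
    fun ⟨_, hn⟩ => S.mem_escapingSet_of_le hn.le⟩

lemma norm_iter_lt {ω : Ω} {z : ℂ} (h : z ∉ S.escapingSet ω) (n : ℕ) :
    ‖S.iter ω n z‖ < S.R + 2 := by
  by_contra! h'
  exact h (S.mem_escapingSet_of_le h')

/-! ### The filled-in Julia sets as a random closed set -/

lemma isOpen_escapingSet (ω : Ω) : IsOpen (S.escapingSet ω) := by
  have : S.escapingSet ω = ⋃ n, {z | S.R + 2 < ‖S.iter ω n z‖} := by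
    ext z; simp [mem_escapingSet_iff]
  rw [this]
  exact isOpen_iUnion fun n => isOpen_lt continuous_const (S.continuous_iter ω n).norm

lemma isClosed_filledJulia (ω : Ω) : IsClosed (S.filledJulia ω) :=
  (S.isOpen_escapingSet ω).isClosed_compl

/-- Compactness gives one time `n` for the whole ball, since the conditions `R + 2 < |fⁿ|` grow with
`n`. Conversely, a non-strict inequality on a dense subset of the open ball passes to its closure,
which is the closed ball when `s ≠ 0`. The right side involves only countably many points, hence is
measurable in `ω`. -/
lemma closedBall_subset_escapingSet_iff {ω : Ω} {z : ℂ} {s : ℝ} (hs : s ≠ 0) :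
    Metric.closedBall z s ⊆ S.escapingSet ω ↔
      ∃ n, ∀ q : ℕ, TopologicalSpace.denseSeq ℂ q ∈ Metric.ball z s →
        S.R + 2 ≤ ‖S.iter ω n (TopologicalSpace.denseSeq ℂ q)‖ := by
  constructor
  · intro h
    obtain ⟨n, hn⟩ := (isCompact_closedBall z s).elim_directed_cover
      (fun n => {z | S.R + 2 < ‖S.iter ω n z‖})
      (fun n => isOpen_lt continuous_const (S.continuous_iter ω n).norm)
      (fun w hw => mem_iUnion.2 (S.mem_escapingSet_iff.1 (h hw)))
      (directed_of_isDirected_le fun n m hnm w hw => by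
        have hw' : S.R + 2 < ‖S.iter ω n w‖ := hw
        exact hw'.trans_le (S.norm_iter_le_norm_iter hw'.le hnm))
    exact ⟨n, fun q hq => (hn (Metric.ball_subset_closedBall hq)).le⟩
  · rintro ⟨n, hn⟩ w hw
    have hcl : IsClosed {z | S.R + 2 ≤ ‖S.iter ω n z‖} :=
      isClosed_le continuous_const (S.continuous_iter ω n).norm
    have hd := (TopologicalSpace.denseRange_denseSeq ℂ).open_subset_closure_inter
      (Metric.isOpen_ball (x := z) (ε := s))
    have hw' : w ∈ closure (Metric.ball z s) := by rwa [closure_ball z hs]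
    refine S.mem_escapingSet_of_le (n := n) (hcl.closure_subset_iff.2 ?_ ((closure_mono hd)
      |>.trans closure_closure.subset <| hw'))
    rintro _ ⟨hx, q, rfl⟩
    exact hn q hx

lemma measurable_infEDist_filledJulia (z : ℂ) :
    Measurable fun ω => Metric.infEDist z (S.filledJulia ω) := by
  refine measurable_of_Ici fun r => ?_
  have key : (fun ω => Metric.infEDist z (S.filledJulia ω)) ⁻¹' Ici r =
      ⋂ s : ℚ, ⋂ (_ : 0 < s ∧ ENNReal.ofReal s < r), ⋃ n, ⋂ q : ℕ,
        ⋂ (_ : TopologicalSpace.denseSeq ℂ q ∈ Metric.ball z (s : ℝ)),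
        {ω | S.R + 2 ≤ ‖S.iter ω n (TopologicalSpace.denseSeq ℂ q)‖} := by
    ext ω
    -- A rational radius fits strictly between a distance and `r`, so countably many closed balls
    -- decide whether the distance is below `r`; `r = ∞` and an empty set need no separate case.
    have aux : (∃ y : ℂ, y ∈ S.filledJulia ω ∧ edist z y < r) ↔
        ∃ s : ℚ, (0 < s ∧ ENNReal.ofReal s < r) ∧
          ¬ Metric.closedBall z (s : ℝ) ⊆ S.escapingSet ω := by
      constructor
      · rintro ⟨y, hy, hyr⟩
        obtain ⟨s, hs0, hs1, hs2⟩ := ENNReal.lt_iff_exists_rat_btwn.1 hyr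
        have hs2' : ENNReal.ofReal s < r := hs2
        have hs1' : edist z y < ENNReal.ofReal s := hs1
        have hpos : (0 : ℝ) < s := ENNReal.ofReal_pos.1 (lt_of_le_of_lt bot_le hs1')
        refine ⟨s, ⟨by exact_mod_cast hpos, hs2'⟩, fun h => hy (h ?_)⟩
        rw [edist_dist, ENNReal.ofReal_lt_ofReal_iff hpos] at hs1'
        rw [Metric.mem_closedBall, dist_comm]
        exact hs1'.le
      · rintro ⟨s, ⟨hs0, hs⟩, h⟩
        obtain ⟨y, hy, hyA⟩ := not_subset.1 h
        refine ⟨y, hyA, lt_of_le_of_lt ?_ hs⟩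
        rw [edist_dist, dist_comm]
        exact ENNReal.ofReal_le_ofReal hy
    rw [mem_preimage, mem_Ici, ← not_lt, Metric.infEDist_lt_iff, aux]
    simp only [mem_iInter, mem_iUnion, mem_ofPred_eq, not_exists, not_and, not_not]
    refine forall_congr' fun s => forall_congr' fun hs => ?_
    exact S.closedBall_subset_escapingSet_iff (by exact_mod_cast hs.1.ne')
  rw [key]
  refine MeasurableSet.iInter fun s => MeasurableSet.iInter fun _ => MeasurableSet.iUnion fun n =>
    MeasurableSet.iInter fun q => MeasurableSet.iInter fun _ => ?_
  exact measurableSet_le measurable_const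
    ((S.measurable_iter n).comp (measurable_id.prodMk measurable_const)).norm

lemma isRandomClosedSet_filledJulia : IsRandomClosedSet S.filledJulia :=
  ⟨S.isClosed_filledJulia, S.measurable_infEDist_filledJulia⟩

end BoundedRandomQuadraticSystem

/-! ### The Fubini–Study potential -/

/-- The potential `½ log (1 + |w|²)` of the Fubini–Study form: a smooth substitute for `log⁺ |w|`. -/
noncomputable def fubiniPotential (w : ℂ) : ℝ := 1 / 2 * Real.log (1 + ‖w‖ ^ 2)

lemma fubiniPotential_nonneg (w : ℂ) : 0 ≤ fubiniPotential w :=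
  mul_nonneg (by norm_num) (Real.log_nonneg (by nlinarith [sq_nonneg ‖w‖]))

lemma fubiniPotential_le {w : ℂ} {r : ℝ} (h : ‖w‖ ≤ r) :
    fubiniPotential w ≤ 1 / 2 * Real.log (1 + r ^ 2) := by
  unfold fubiniPotential
  gcongr

lemma continuous_fubiniPotential : Continuous fubiniPotential :=
  continuous_const.mul (Continuous.log (by fun_prop) fun w => by positivity)

lemma fubiniPotential_sub_log_mem_Icc {w : ℂ} (hw : w ≠ 0) :
    fubiniPotential w - Real.log ‖w‖ ∈ Icc 0 (1 / 2 * (‖w‖ ^ 2)⁻¹) := by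
  have hpos : 0 < ‖w‖ := norm_pos_iff.2 hw
  have h1 : fubiniPotential w - Real.log ‖w‖ = 1 / 2 * Real.log (1 + (‖w‖ ^ 2)⁻¹) := by
    have : 1 + ‖w‖ ^ 2 = ‖w‖ ^ 2 * (1 + (‖w‖ ^ 2)⁻¹) := by field_simp; ring
    rw [fubiniPotential, this, Real.log_mul (by positivity) (by positivity), Real.log_pow]
    push_cast; ring
  rw [h1]
  have h2 : 0 < (‖w‖ ^ 2)⁻¹ := by positivity
  constructor
  · exact mul_nonneg (by norm_num) (Real.log_nonneg (by linarith))
  · have := Real.log_le_sub_one_of_pos (x := 1 + (‖w‖ ^ 2)⁻¹) (by linarith)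
    linarith

lemma abs_fubiniPotential_sub_log_le {w : ℂ} (hw : 1 ≤ ‖w‖) :
    |fubiniPotential w - Real.log ‖w‖| ≤ 1 / 2 := by
  have h0 : w ≠ 0 := norm_pos_iff.1 (by linarith)
  obtain ⟨h1, h2⟩ := fubiniPotential_sub_log_mem_Icc h0
  rw [abs_of_nonneg h1]
  have : (‖w‖ ^ 2)⁻¹ ≤ 1 := inv_le_one_of_one_le₀ (one_le_pow₀ hw)
  linarith

lemma tendsto_fubiniPotential_sub_log :
    Tendsto (fun w : ℂ => fubiniPotential w - Real.log ‖w‖) (Bornology.cobounded ℂ) (𝓝 0) := by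
  have h1 : Tendsto (fun w : ℂ => 1 / 2 * (‖w‖ ^ 2)⁻¹) (Bornology.cobounded ℂ) (𝓝 0) := by
    have := (tendsto_inv_atTop_zero.comp ((tendsto_pow_atTop two_ne_zero).comp
      (tendsto_norm_cobounded_atTop (E := ℂ)))).const_mul (1 / 2)
    simpa using this
  have h2 : ∀ᶠ w : ℂ in Bornology.cobounded ℂ, w ≠ 0 := (Bornology.eventually_ne_cobounded (0 : ℂ))
  refine tendsto_of_tendsto_of_tendsto_of_le_of_le' tendsto_const_nhds h1 ?_ ?_
  · filter_upwards [h2] with w hw using (fubiniPotential_sub_log_mem_Icc hw).1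
  · filter_upwards [h2] with w hw using (fubiniPotential_sub_log_mem_Icc hw).2

/-- The bound for the defect `fubiniPotential (w² + c) - 2 fubiniPotential w`, for `|c| < R`. -/
noncomputable def potentialDefectBound (R : ℝ) : ℝ := 1 / 2 * Real.log (4 + 4 * R ^ 2)

lemma potentialDefectBound_nonneg (R : ℝ) : 0 ≤ potentialDefectBound R :=
  mul_nonneg (by norm_num) (Real.log_nonneg (by nlinarith [sq_nonneg R]))

lemma abs_fubiniPotential_sq_add_sub_le {R : ℝ} {c : ℂ} (hc : ‖c‖ < R) (w : ℂ) :
    |fubiniPotential (w ^ 2 + c) - 2 * fubiniPotential w| ≤ potentialDefectBound R := by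
  have h1 := norm_add_le (w ^ 2) c
  have h2 := norm_add_le (w ^ 2 + c) (-c)
  rw [add_neg_cancel_right, norm_neg] at h2
  rw [norm_pow] at h1 h2
  have hc0 := norm_nonneg c
  set t := ‖w‖ with ht
  set s := ‖w ^ 2 + c‖ with hs
  have ht0 : 0 ≤ t := norm_nonneg _
  have hs0 : 0 ≤ s := norm_nonneg _
  have hcR : ‖c‖ ^ 2 ≤ R ^ 2 := by gcongr
  have hsq : s ^ 2 ≤ (t ^ 2 + ‖c‖) ^ 2 := by gcongr
  have hsq' : (t ^ 2) ^ 2 ≤ (s + ‖c‖) ^ 2 := by gcongr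
  have ha : 1 + s ^ 2 ≤ (4 + 4 * R ^ 2) * (1 + t ^ 2) ^ 2 := by
    nlinarith [sq_nonneg (t ^ 2 - ‖c‖), sq_nonneg R, sq_nonneg t, mul_nonneg (sq_nonneg R)
      (sq_nonneg t), mul_nonneg (sq_nonneg R) (sq_nonneg (t ^ 2))]
  -- The constant comes from `(1 + t²)² ≤ 2 + 2t⁴ ≤ 2 + 4s² + 4R²`.
  have hb : (1 + t ^ 2) ^ 2 ≤ (4 + 4 * R ^ 2) * (1 + s ^ 2) := by
    nlinarith [sq_nonneg (s - ‖c‖), sq_nonneg (t ^ 2 - 1), mul_nonneg (sq_nonneg R) (sq_nonneg s)]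
  have e : fubiniPotential (w ^ 2 + c) - 2 * fubiniPotential w
      = 1 / 2 * (Real.log (1 + s ^ 2) - Real.log ((1 + t ^ 2) ^ 2)) := by
    rw [Real.log_pow]; simp only [fubiniPotential, ← ht, ← hs]; push_cast; ring
  have la := Real.log_le_log (by positivity) ha
  have lb := Real.log_le_log (by positivity) hb
  rw [Real.log_mul (by positivity) (by positivity)] at la lb
  rw [e, potentialDefectBound, abs_mul, abs_of_pos (by norm_num : (0 : ℝ) < 1 / 2)]
  have : |Real.log (1 + s ^ 2) - Real.log ((1 + t ^ 2) ^ 2)| ≤ Real.log (4 + 4 * R ^ 2) :=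
    abs_le.2 ⟨by linarith, by linarith⟩
  linarith

lemma tendsto_sq_add_cobounded (c : ℂ) :
    Tendsto (fun w : ℂ => w ^ 2 + c) (Bornology.cobounded ℂ) (Bornology.cobounded ℂ) := by
  rw [← tendsto_norm_atTop_iff_cobounded]
  have h : Tendsto (fun w : ℂ => ‖w‖ ^ 2 - ‖c‖) (Bornology.cobounded ℂ) atTop :=
    tendsto_atTop_add_const_right _ _
      ((tendsto_pow_atTop two_ne_zero).comp (tendsto_norm_cobounded_atTop (E := ℂ)))
  refine tendsto_atTop_mono (fun w => ?_) h
  have := norm_sub_le_norm_add (w ^ 2) c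
  rwa [norm_pow] at this

/-- Up to terms vanishing at infinity, the defect is `log|w² + c| - 2 log|w| = log|1 + c/w²|`. The
limit `0` is what later fixes the total mass. -/
lemma tendsto_fubiniPotential_sq_add_sub (c : ℂ) :
    Tendsto (fun w : ℂ => fubiniPotential (w ^ 2 + c) - 2 * fubiniPotential w)
      (Bornology.cobounded ℂ) (𝓝 0) := by
  have h1 := tendsto_fubiniPotential_sub_log.comp (tendsto_sq_add_cobounded c)
  have h2 := tendsto_fubiniPotential_sub_log.const_mul 2
  have h3 : Tendsto (fun w : ℂ => Real.log ‖1 + c * (w ^ 2)⁻¹‖) (Bornology.cobounded ℂ) (𝓝 0) := by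
    have h4 : Tendsto (fun w : ℂ => 1 + c * (w⁻¹) ^ 2) (Bornology.cobounded ℂ) (𝓝 1) := by
      simpa using (((tendsto_inv₀_cobounded (α := ℂ)).pow 2).const_mul c).const_add 1
    have h5 := (Real.continuousAt_log (x := ‖(1 : ℂ)‖) (by simp)).tendsto.comp h4.norm
    simpa [Function.comp_def] using h5
  have h6 := (h1.sub h2).add h3
  simp only [mul_zero, sub_zero, add_zero] at h6
  refine h6.congr' ?_
  filter_upwards [(Bornology.eventually_ne_cobounded (0 : ℂ)),
    (tendsto_sq_add_cobounded c).eventually (Bornology.eventually_ne_cobounded (0 : ℂ))] with w hw hw'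
  have e : w ^ 2 + c = w ^ 2 * (1 + c * (w ^ 2)⁻¹) := by field_simp
  have e' : 1 + c * (w ^ 2)⁻¹ ≠ 0 := by
    intro h; rw [h, mul_zero] at e; exact hw' e
  have : Real.log ‖w ^ 2 + c‖ = 2 * Real.log ‖w‖ + Real.log ‖1 + c * (w ^ 2)⁻¹‖ := by
    rw [e, norm_mul, Real.log_mul (by simpa using hw) (by simpa using e'), norm_pow, Real.log_pow]
    push_cast; ring
  simp only [Function.comp_apply]
  rw [this]; ring

namespace BoundedRandomQuadraticSystem

variable {Ω : Type*} [MeasurableSpace Ω] {P : Measure Ω} (S : BoundedRandomQuadraticSystem P)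

/-! ### Smooth approximations of the Green function -/

/-- The smooth approximation `2 ^ (-n) ½ log (1 + |f_ω ^ n (z)|²)` of the Green function. -/
noncomputable def smoothGreen (ω : Ω) (n : ℕ) (z : ℂ) : ℝ :=
  fubiniPotential (S.iter ω n z) / 2 ^ n

@[simp] lemma smoothGreen_zero (ω : Ω) (z : ℂ) : S.smoothGreen ω 0 z = fubiniPotential z := by
  simp [smoothGreen]

lemma smoothGreen_succ_sub (ω : Ω) (n : ℕ) (z : ℂ) :
    S.smoothGreen ω (n + 1) z - S.smoothGreen ω n z =
      (fubiniPotential (S.iter ω n z ^ 2 + S.c (S.σ^[n] ω)) -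
        2 * fubiniPotential (S.iter ω n z)) / 2 ^ (n + 1) := by
  rw [smoothGreen, smoothGreen, iter_succ, pow_succ]
  field_simp
  ring

lemma continuous_smoothGreen (ω : Ω) (n : ℕ) : Continuous (S.smoothGreen ω n) :=
  (continuous_fubiniPotential.comp (S.continuous_iter ω n)).div_const _

lemma dist_smoothGreen_succ_le (ω : Ω) (z : ℂ) (n : ℕ) :
    dist (S.smoothGreen ω n z) (S.smoothGreen ω (n + 1) z) ≤
      potentialDefectBound S.R / 2 / 2 ^ n := by
  rw [dist_comm, Real.dist_eq, smoothGreen_succ_sub, abs_div,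
    abs_of_pos (by positivity : (0 : ℝ) < 2 ^ (n + 1)), pow_succ' (2 : ℝ) n, div_div]
  exact div_le_div_of_nonneg_right (abs_fubiniPotential_sq_add_sub_le (S.norm_c_lt _) _)
    (by positivity)

lemma exists_tendsto_smoothGreen (ω : Ω) (z : ℂ) :
    ∃ l, Tendsto (fun n => S.smoothGreen ω n z) atTop (𝓝 l) :=
  cauchySeq_tendsto_of_complete (cauchySeq_of_le_geometric_two (S.dist_smoothGreen_succ_le ω z))

lemma tendsto_log_iter_of_tendsto_smoothGreen {ω : Ω} {z : ℂ} {l : ℝ} (hz : z ∈ S.escapingSet ω)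
    (h : Tendsto (fun n => S.smoothGreen ω n z) atTop (𝓝 l)) :
    Tendsto (fun n : ℕ => 1 / 2 ^ n * Real.log ‖S.iter ω n z‖) atTop (𝓝 l) := by
  have h1 : Tendsto (fun n => S.smoothGreen ω n z - 1 / 2 ^ n * Real.log ‖S.iter ω n z‖)
      atTop (𝓝 0) := by
    have h2 := tendsto_fubiniPotential_sub_log.comp hz
    have h3 := h2.mul (tendsto_pow_atTop_nhds_zero_of_lt_one (r := (1 / 2 : ℝ))
      (by norm_num) (by norm_num))
    rw [mul_zero] at h3
    refine h3.congr fun n => ?_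
    simp only [Function.comp_apply, smoothGreen, one_div, inv_pow]
    ring
  simpa using h.sub h1

/-- The smooth approximations converge to the Green function at every point of the plane. -/
lemma tendsto_smoothGreen (ω : Ω) (z : ℂ) :
    Tendsto (fun n => S.smoothGreen ω n z) atTop (𝓝 (S.green ω z)) := by
  by_cases hz : z ∈ S.escapingSet ω
  · obtain ⟨l, hl⟩ := S.exists_tendsto_smoothGreen ω z
    rwa [green, if_pos hz, (S.tendsto_log_iter_of_tendsto_smoothGreen hz hl).limUnder_eq]
  · rw [green, if_neg hz]
    -- A non-escaping orbit never reaches `R + 2`, so the numerators stay bounded.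
    have h1 : Tendsto (fun n : ℕ => 1 / 2 * Real.log (1 + (S.R + 2) ^ 2) * (1 / 2 : ℝ) ^ n) atTop
        (𝓝 0) := by
      simpa using (tendsto_pow_atTop_nhds_zero_of_lt_one (r := (1 / 2 : ℝ))
        (by norm_num) (by norm_num)).const_mul (1 / 2 * Real.log (1 + (S.R + 2) ^ 2))
    refine squeeze_zero (fun n => div_nonneg (fubiniPotential_nonneg _) (by positivity))
      (fun n => ?_) h1
    rw [smoothGreen, one_div_pow, mul_one_div]
    gcongr
    exact fubiniPotential_le (S.norm_iter_lt hz n).le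

lemma tendsto_log_iter {ω : Ω} {z : ℂ} (hz : z ∈ S.escapingSet ω) :
    Tendsto (fun n : ℕ => 1 / 2 ^ n * Real.log ‖S.iter ω n z‖) atTop (𝓝 (S.green ω z)) :=
  S.tendsto_log_iter_of_tendsto_smoothGreen hz (S.tendsto_smoothGreen ω z)

lemma green_of_notMem {ω : Ω} {z : ℂ} (hz : z ∉ S.escapingSet ω) : S.green ω z = 0 := if_neg hz

lemma dist_smoothGreen_green_le (ω : Ω) (n : ℕ) (z : ℂ) :
    dist (S.smoothGreen ω n z) (S.green ω z) ≤ potentialDefectBound S.R / 2 ^ n :=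
  dist_le_of_le_geometric_two_of_tendsto (S.dist_smoothGreen_succ_le ω z)
    (S.tendsto_smoothGreen ω z) n

lemma tendstoUniformly_smoothGreen (ω : Ω) :
    TendstoUniformly (S.smoothGreen ω) (S.green ω) atTop := by
  rw [Metric.tendstoUniformly_iff]
  intro ε hε
  have h : Tendsto (fun n : ℕ => potentialDefectBound S.R * (1 / 2 : ℝ) ^ n) atTop (𝓝 0) := by
    simpa using (tendsto_pow_atTop_nhds_zero_of_lt_one (r := (1 / 2 : ℝ))
      (by norm_num) (by norm_num)).const_mul (potentialDefectBound S.R)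
  filter_upwards [h.eventually_lt_const hε] with n hn z
  rw [dist_comm]
  refine (S.dist_smoothGreen_green_le ω n z).trans_lt ?_
  rwa [one_div_pow, mul_one_div] at hn

lemma continuous_green (ω : Ω) : Continuous (S.green ω) :=
  (S.tendstoUniformly_smoothGreen ω).continuous
    (Frequently.of_forall fun n => S.continuous_smoothGreen ω n)

lemma abs_green_sub_fubiniPotential_le (ω : Ω) (z : ℂ) :
    |S.green ω z - fubiniPotential z| ≤ potentialDefectBound S.R := by
  have := S.dist_smoothGreen_green_le ω 0 z
  rwa [smoothGreen_zero, dist_comm, Real.dist_eq, pow_zero, div_one] at this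

lemma abs_green_le (ω : Ω) {z : ℂ} {r : ℝ} (hz : ‖z‖ ≤ r) :
    |S.green ω z| ≤ potentialDefectBound S.R + 1 / 2 * Real.log (1 + r ^ 2) := by
  have h1 := abs_le.1 (S.abs_green_sub_fubiniPotential_le ω z)
  have h2 := fubiniPotential_le hz
  have h3 := fubiniPotential_nonneg z
  exact abs_le.2 ⟨by linarith [h1.1, potentialDefectBound_nonneg S.R], by linarith [h1.2]⟩

/-! ### Behaviour at infinity and positivity -/

lemma tendsto_iter_cobounded (ω : Ω) (n : ℕ) :
    Tendsto (S.iter ω n) (Bornology.cobounded ℂ) (Bornology.cobounded ℂ) := by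
  induction n with
  | zero => exact tendsto_id
  | succ n ih => exact (tendsto_sq_add_cobounded _).comp ih

lemma tendsto_smoothGreen_sub_fubiniPotential (ω : Ω) (n : ℕ) :
    Tendsto (fun z => S.smoothGreen ω n z - fubiniPotential z) (Bornology.cobounded ℂ) (𝓝 0) := by
  induction n with
  | zero => simp
  | succ n ih =>
    have h := ((tendsto_fubiniPotential_sq_add_sub (S.c (S.σ^[n] ω))).comp
      (S.tendsto_iter_cobounded ω n)).div_const (2 ^ (n + 1))
    rw [zero_div] at h
    have h2 := h.add ih
    rw [zero_add] at h2
    refine h2.congr fun z => ?_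
    have := S.smoothGreen_succ_sub ω n z
    simp only [Function.comp_apply]
    rw [← this]; ring

/-- The Green function is asymptotic to `log |z|` at infinity, with vanishing Robin constant. -/
lemma tendsto_green_sub_fubiniPotential (ω : Ω) :
    Tendsto (fun z => S.green ω z - fubiniPotential z) (Bornology.cobounded ℂ) (𝓝 0) := by
  rw [Metric.tendsto_nhds]
  intro ε hε
  -- Convergence uniform on the whole plane allows the limits in `n` and at infinity to be
  -- interchanged.
  obtain ⟨n, hn⟩ := (Metric.tendstoUniformly_iff.1 (S.tendstoUniformly_smoothGreen ω) (ε / 2)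
    (half_pos hε)).exists
  filter_upwards [Metric.tendsto_nhds.1 (S.tendsto_smoothGreen_sub_fubiniPotential ω n) (ε / 2)
    (half_pos hε)] with z hz
  have h := hn z
  rw [Real.dist_eq] at *
  rw [sub_zero] at *
  calc |S.green ω z - fubiniPotential z|
      = |(S.green ω z - S.smoothGreen ω n z) + (S.smoothGreen ω n z - fubiniPotential z)| := by
        ring_nf
    _ ≤ _ := abs_add_le _ _
    _ < ε := by linarith

/-- By `|f(w)| ≥ |w|²/2`, the quantity `log|fⁿ| - log 2` at least doubles at each step after time
`N`, and it is positive there because `|fᴺ| > R + 2 > 2`. -/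
lemma green_pos {ω : Ω} {z : ℂ} (hz : z ∈ S.escapingSet ω) : 0 < S.green ω z := by
  obtain ⟨N, hN⟩ := S.mem_escapingSet_iff.1 hz
  have hge : ∀ k, 2 ^ k * (Real.log ‖S.iter ω N z‖ - Real.log 2) ≤
      Real.log ‖S.iter ω (N + k) z‖ - Real.log 2 := by
    intro k
    induction k with
    | zero => simp
    | succ k ih =>
      have h1 : S.R + 2 ≤ ‖S.iter ω (N + k) z‖ :=
        hN.le.trans (S.norm_iter_le_norm_iter hN.le (Nat.le_add_right _ _))
      have h2 := half_norm_sq_le_norm_sq_add S.R_pos (S.norm_c_lt (S.σ^[N + k] ω)) h1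
      have h3 : 0 < ‖S.iter ω (N + k) z‖ := by linarith [S.R_pos]
      have h4 := Real.log_le_log (by positivity) h2
      rw [Real.log_div (by positivity) (by norm_num), Real.log_pow] at h4
      rw [← add_assoc, iter_succ, pow_succ]
      push_cast at h4
      linarith
  have hlog : 0 < Real.log ‖S.iter ω N z‖ - Real.log 2 :=
    sub_pos.2 (Real.log_lt_log (by norm_num) (by linarith [S.R_pos]))
  refine lt_of_lt_of_le (div_pos hlog (by positivity : (0 : ℝ) < 2 ^ N))
    (ge_of_tendsto (S.tendsto_log_iter hz) ?_)
  filter_upwards [eventually_ge_atTop N] with n hn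
  obtain ⟨k, rfl⟩ := Nat.exists_eq_add_of_le hn
  have hl2 : 0 < Real.log 2 := Real.log_pos (by norm_num)
  have := hge k
  rw [one_div_mul_eq_div, div_le_div_iff₀ (by positivity) (by positivity), pow_add]
  have h2N : (0 : ℝ) < 2 ^ N := by positivity
  nlinarith

lemma isBigO_green_sub_log (ω : Ω) :
    (fun z => S.green ω z - Real.log ‖z‖) =O[Bornology.cobounded ℂ] (fun _ => (1 : ℝ)) := by
  refine Asymptotics.IsBigO.of_bound (potentialDefectBound S.R + 1 / 2) ?_
  filter_upwards [tendsto_norm_cobounded_atTop.eventually_ge_atTop (1 : ℝ)] with z hz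
  rw [norm_one, mul_one, Real.norm_eq_abs]
  calc |S.green ω z - Real.log ‖z‖|
      = |(S.green ω z - fubiniPotential z) + (fubiniPotential z - Real.log ‖z‖)| := by ring_nf
    _ ≤ _ := abs_add_le _ _
    _ ≤ _ := add_le_add (S.abs_green_sub_fubiniPotential_le ω z)
      (abs_fubiniPotential_sub_log_le hz)

lemma escapingSet_mem_cobounded (ω : Ω) : S.escapingSet ω ∈ Bornology.cobounded ℂ := by
  filter_upwards [tendsto_norm_cobounded_atTop.eventually_ge_atTop (S.R + 2)] with z hz
  exact S.mem_escapingSet_of_le (n := 0) hz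

/-! ### Measurability, and integrability of the supremum over a disc -/

lemma measurable_smoothGreen (n : ℕ) : Measurable fun p : Ω × ℂ => S.smoothGreen p.1 n p.2 := by
  have h := continuous_fubiniPotential.measurable.comp (S.measurable_iter n)
  simpa only [smoothGreen] using! h.div_const (2 ^ n)

/-- Joint measurability, not just measurability at each point, is needed for the parameter integrals
in `measurable_equilibriumMeasure`. -/
lemma measurable_green : Measurable fun p : Ω × ℂ => S.green p.1 p.2 := by
  refine measurable_of_tendsto_metrizable S.measurable_smoothGreen ?_
  rw [tendsto_pi_nhds]
  exact fun p => S.tendsto_smoothGreen p.1 p.2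

lemma measurable_green_apply (z : ℂ) : Measurable fun ω => S.green ω z := by
  have h : Measurable fun ω : Ω => (ω, z) := measurable_id.prodMk measurable_const
  have h' := S.measurable_green.comp h
  exact h'

lemma isRandomContinuous_green [IsFiniteMeasure P] {r : ℝ} (hr : 0 < r) :
    IsRandomContinuous P (fun ω (z : Metric.ball (0 : ℂ) r) => S.green ω z) := by
  have hb : ∀ ω (z : Metric.ball (0 : ℂ) r), |S.green ω z| ≤
      potentialDefectBound S.R + 1 / 2 * Real.log (1 + r ^ 2) :=
    fun ω z => S.abs_green_le ω (mem_ball_zero_iff.1 z.2).le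
  have : Nonempty (Metric.ball (0 : ℂ) r) := ⟨0, Metric.mem_ball_self hr⟩
  have hbdd : ∀ ω, BddAbove (range fun z : Metric.ball (0 : ℂ) r => |S.green ω z|) :=
    fun ω => ⟨_, forall_mem_range.2 (hb ω)⟩
  refine ⟨fun ω => (S.continuous_green ω).comp continuous_subtype_val, fun ω => ⟨_, hb ω⟩,
    fun z => S.measurable_green_apply z,
    Integrable.of_bound ?_ (potentialDefectBound S.R + 1 / 2 * Real.log (1 + r ^ 2))
      (ae_of_all _ fun ω => ?_)⟩
  · refine (measurable_of_Iic fun t => ?_).aestronglyMeasurable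
    -- By continuity the supremum is determined on a countable dense set.
    have : (fun ω => ⨆ z : Metric.ball (0 : ℂ) r, |S.green ω z|) ⁻¹' Iic t =
        ⋂ q : ℕ, {ω | |S.green ω (TopologicalSpace.denseSeq (Metric.ball (0 : ℂ) r) q)| ≤ t} := by
      ext ω
      simp only [mem_preimage, mem_Iic, ciSup_le_iff (hbdd ω), mem_iInter, mem_ofPred_eq]
      refine ⟨fun h q => h _, fun h z => ?_⟩
      refine (TopologicalSpace.denseRange_denseSeq (Metric.ball (0 : ℂ) r)).induction_on
        (p := fun z => |S.green ω z| ≤ t) z ?_ h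
      exact isClosed_le ((S.continuous_green ω).comp continuous_subtype_val).abs continuous_const
    rw [this]
    exact MeasurableSet.iInter fun q => measurableSet_le (S.measurable_green_apply _).abs
      measurable_const
  · rw [Real.norm_eq_abs, abs_of_nonneg (Real.iSup_nonneg fun z => abs_nonneg _)]
    exact ciSup_le (hb ω)

/-! ### Harmonicity of the Green function -/

/-- The terms of the logarithm of the Böttcher product, started at time `N`. -/
noncomputable def boettcherTerm (ω : Ω) (N k : ℕ) (z : ℂ) : ℂ :=
  (1 / 2 ^ (N + k + 1) : ℂ) *
    Complex.log (1 + S.c (S.σ^[N + k] ω) / S.iter ω (N + k) z ^ 2)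

/-- Keeps `1 + c/f²` within `1/2` of `1`, where the principal logarithm is holomorphic and bounded
linearly. -/
lemma norm_c_div_sq_le {ω ω' : Ω} {n : ℕ} {z : ℂ} (h : S.R + 2 ≤ ‖S.iter ω n z‖) :
    ‖S.c ω' / S.iter ω n z ^ 2‖ ≤ 1 / 2 := by
  have hpos : 0 < ‖S.iter ω n z‖ := by linarith [S.R_pos]
  rw [norm_div, norm_pow, div_le_div_iff₀ (by positivity) (by norm_num)]
  nlinarith [S.norm_c_lt ω', S.R_pos]

lemma norm_boettcherTerm_le {ω : Ω} {N : ℕ} {z : ℂ} (h : S.R + 2 ≤ ‖S.iter ω N z‖) (k : ℕ) :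
    ‖S.boettcherTerm ω N k z‖ ≤ (1 / 2 : ℝ) ^ k := by
  have h1 : S.R + 2 ≤ ‖S.iter ω (N + k) z‖ := h.trans (S.norm_iter_le_norm_iter h (by lia))
  have h2 := S.norm_c_div_sq_le (ω' := S.σ^[N + k] ω) h1
  have h3 := Complex.norm_log_one_add_half_le_self h2
  rw [boettcherTerm, norm_mul, norm_div, norm_pow, norm_one, Complex.norm_ofNat]
  have h4 : (1 : ℝ) / 2 ^ (N + k + 1) ≤ (1 / 2) ^ k := by
    rw [one_div_pow]
    exact one_div_le_one_div_of_le (by positivity)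
      (pow_le_pow_right₀ (by norm_num) (by lia))
  -- The logarithm is at most `3/2 · 1/2 ≤ 1` in norm.
  calc _ ≤ (1 / 2 : ℝ) ^ k * 1 := by gcongr; linarith
    _ = _ := mul_one _

lemma differentiableAt_boettcherTerm {ω : Ω} {N : ℕ} {z : ℂ} (h : S.R + 2 ≤ ‖S.iter ω N z‖)
    (k : ℕ) : DifferentiableAt ℂ (S.boettcherTerm ω N k) z := by
  have h1 : S.R + 2 ≤ ‖S.iter ω (N + k) z‖ := h.trans (S.norm_iter_le_norm_iter h (by lia))
  have h2 := S.norm_c_div_sq_le (ω' := S.σ^[N + k] ω) h1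
  have h0 : S.iter ω (N + k) z ≠ 0 := norm_pos_iff.1 (by linarith [S.R_pos])
  refine DifferentiableAt.const_mul (DifferentiableAt.clog ?_ ?_) _
  · exact ((differentiableAt_const _).div ((S.differentiable_iter ω (N + k) z).pow 2)
      (pow_ne_zero 2 h0)).const_add 1
  · exact Complex.mem_slitPlane_of_norm_lt_one (h2.trans_lt (by norm_num))

lemma sum_re_boettcherTerm {ω : Ω} {N : ℕ} {z : ℂ} (h : S.R + 2 ≤ ‖S.iter ω N z‖) (m : ℕ) :
    ∑ k ∈ Finset.range m, (S.boettcherTerm ω N k z).re =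
      1 / 2 ^ (N + m) * Real.log ‖S.iter ω (N + m) z‖ - 1 / 2 ^ N * Real.log ‖S.iter ω N z‖ := by
  induction m with
  | zero => simp
  | succ m ih =>
    have h1 : S.R + 2 ≤ ‖S.iter ω (N + m) z‖ := h.trans (S.norm_iter_le_norm_iter h (by lia))
    have h0 : S.iter ω (N + m) z ≠ 0 := norm_pos_iff.1 (by linarith [S.R_pos])
    have h2 : S.iter ω (N + m + 1) z ≠ 0 :=
      norm_pos_iff.1 (by linarith [S.R_pos, S.norm_iter_le_norm_iter h1 (Nat.le_succ _)])
    -- Each factor is the quotient of an iterate by the square of the previous one, so the weighted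
    -- logarithms telescope.
    have e : 1 + S.c (S.σ^[N + m] ω) / S.iter ω (N + m) z ^ 2 =
        S.iter ω (N + m + 1) z / S.iter ω (N + m) z ^ 2 := by
      rw [iter_succ]; field_simp
    have e2 : (S.boettcherTerm ω N m z).re = 1 / 2 ^ (N + m + 1) *
        (Real.log ‖S.iter ω (N + m + 1) z‖ - 2 * Real.log ‖S.iter ω (N + m) z‖) := by
      have : (1 / 2 ^ (N + m + 1) : ℂ) = ((1 / 2 ^ (N + m + 1) : ℝ) : ℂ) := by push_cast; rfl
      rw [boettcherTerm, this, Complex.re_ofReal_mul, e, Complex.log_re, norm_div, norm_pow,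
        Real.log_div (by simpa using h2) (by simpa using h0), Real.log_pow]
      norm_num
    rw [Finset.sum_range_succ, ih, e2, ← add_assoc, pow_succ]
    field_simp
    ring

lemma green_eq_log_add_re_tsum {ω : Ω} {N : ℕ} {z : ℂ} (h : S.R + 2 ≤ ‖S.iter ω N z‖) :
    S.green ω z = 1 / 2 ^ N * Real.log ‖S.iter ω N z‖ + (∑' k, S.boettcherTerm ω N k z).re := by
  have hs : Summable fun k => S.boettcherTerm ω N k z :=
    Summable.of_norm_bounded (summable_geometric_two) (S.norm_boettcherTerm_le h)
  have h1 := (Complex.hasSum_re hs.hasSum).tendsto_sum_nat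
  simp only [S.sum_re_boettcherTerm h] at h1
  have h2 := ((tendsto_add_atTop_iff_nat N).2 (S.tendsto_log_iter (S.mem_escapingSet_of_le h)))
  simp only [add_comm _ N] at h2
  have h3 := tendsto_nhds_unique h1 (h2.sub_const _)
  linarith

/-- On the open set `|fᴺ| > R + 2` the iterate `fᴺ` has no zeros and the series converges normally
to a holomorphic function; `green_eq_log_add_re_tsum` then exhibits two harmonic summands. -/
lemma harmonicOnNhd_green (ω : Ω) :
    InnerProductSpace.HarmonicOnNhd (S.green ω) (S.escapingSet ω) := by
  intro z hz
  obtain ⟨N, hN⟩ := S.mem_escapingSet_iff.1 hz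
  set V : Set ℂ := {w | S.R + 2 < ‖S.iter ω N w‖} with hV
  have hVo : IsOpen V := isOpen_lt continuous_const (S.continuous_iter ω N).norm
  have hVz : V ∈ 𝓝 z := hVo.mem_nhds hN
  have hd : DifferentiableOn ℂ (fun w => ∑' k, S.boettcherTerm ω N k w) V :=
    Complex.differentiableOn_tsum_of_summable_norm summable_geometric_two
      (fun k w hw => (S.differentiableAt_boettcherTerm (le_of_lt hw) k).differentiableWithinAt) hVo
      (fun k w hw => S.norm_boettcherTerm_le (le_of_lt hw) k)
  have h1 : InnerProductSpace.HarmonicAt (fun w => (∑' k, S.boettcherTerm ω N k w).re) z :=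
    (hd.analyticAt hVz).harmonicAt_re
  have h2 : InnerProductSpace.HarmonicAt (fun w => Real.log ‖S.iter ω N w‖) z :=
    ((S.differentiable_iter ω N).analyticAt z).harmonicAt_log_norm
      (norm_pos_iff.1 (by linarith [S.R_pos]))
  have h3 := (h2.const_smul (c := (1 / 2 ^ N : ℝ))).add h1
  refine (InnerProductSpace.harmonicAt_congr_nhds ?_).1 h3
  filter_upwards [hVz] with w hw
  rw [S.green_eq_log_add_re_tsum (le_of_lt hw)]
  simp

lemma isGreenFunctionAtInfinity (ω : Ω) :
    IsGreenFunctionAtInfinity (S.escapingSet ω) (S.green ω) where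
  isOpen := S.isOpen_escapingSet ω
  nhds_infty := S.escapingSet_mem_cobounded ω
  harmonic := S.harmonicOnNhd_green ω
  pos _ hz := S.green_pos hz
  log_pole := S.isBigO_green_sub_log ω
  boundary ζ hζ := by
    have h : ζ ∉ S.escapingSet ω := by
      rw [(S.isOpen_escapingSet ω).frontier_eq] at hζ
      exact hζ.2
    rw [← S.green_of_notMem h]
    exact ((S.continuous_green ω).tendsto ζ).mono_left nhdsWithin_le_nhds

end BoundedRandomQuadraticSystem

/-! ### The Laplacian in the plane and Green's identity -/

lemma fderiv_fderiv_apply_const {v : ℂ → ℝ} (hv : ContDiff ℝ 2 v) (z e : ℂ) :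
    fderiv ℝ (fun w => fderiv ℝ v w e) z e = iteratedFDeriv ℝ 2 v z ![e, e] := by
  have hd : DifferentiableAt ℝ (fderiv ℝ v) z :=
    (hv.fderiv_right (m := 1) (by norm_num)).differentiable (by norm_num) z
  rw [iteratedFDeriv_two_apply, fderiv_clm_apply hd (differentiableAt_const e)]
  simp

lemma laplacian_eq_fderiv_fderiv {v : ℂ → ℝ} (hv : ContDiff ℝ 2 v) (z : ℂ) :
    Laplacian.laplacian v z = fderiv ℝ (fun w => fderiv ℝ v w 1) z 1 +
      fderiv ℝ (fun w => fderiv ℝ v w Complex.I) z Complex.I := by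
  rw [fderiv_fderiv_apply_const hv, fderiv_fderiv_apply_const hv,
    InnerProductSpace.laplacian_eq_iteratedFDeriv_complexPlane]

lemma contDiff_fderiv_apply_const {v : ℂ → ℝ} (hv : ContDiff ℝ 2 v) (e : ℂ) :
    ContDiff ℝ 1 fun w => fderiv ℝ v w e :=
  (hv.fderiv_right (m := 1) (by norm_num)).clm_apply contDiff_const

lemma continuous_fderiv_apply_const {v : ℂ → ℝ} (hv : ContDiff ℝ 1 v) (e : ℂ) :
    Continuous fun w => fderiv ℝ v w e :=
  (hv.continuous_fderiv (by norm_num)).clm_apply continuous_const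

lemma continuous_laplacian {v : ℂ → ℝ} (hv : ContDiff ℝ 2 v) :
    Continuous (Laplacian.laplacian v) := by
  rw [funext (laplacian_eq_fderiv_fderiv hv)]
  exact (continuous_fderiv_apply_const (contDiff_fderiv_apply_const hv 1) 1).add
    (continuous_fderiv_apply_const (contDiff_fderiv_apply_const hv Complex.I) Complex.I)

lemma laplacian_eq_zero_of_notMem_tsupport {φ : ℂ → ℝ} {z : ℂ} (hz : z ∉ tsupport φ) :
    Laplacian.laplacian φ z = 0 := by
  have h := (InnerProductSpace.laplacian_congr_nhds
    (notMem_tsupport_iff_eventuallyEq.1 hz)).self_of_nhds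
  rw [h]
  exact congrFun (InnerProductSpace.laplacian_const (E := ℂ) (c := (0 : ℝ))) z

lemma hasCompactSupport_laplacian {φ : ℂ → ℝ} (hφ : HasCompactSupport φ) :
    HasCompactSupport (Laplacian.laplacian φ : ℂ → ℝ) :=
  HasCompactSupport.intro hφ fun _ hz => laplacian_eq_zero_of_notMem_tsupport hz

lemma hasCompactSupport_fderiv_apply {φ : ℂ → ℝ} (hφ : HasCompactSupport φ) (e : ℂ) :
    HasCompactSupport fun w => fderiv ℝ φ w e :=
  hφ.fderiv_apply ℝ e

lemma integral_mul_fderiv_eq_neg {v φ : ℂ → ℝ} (hv : ContDiff ℝ 1 v) (hφ : ContDiff ℝ 1 φ)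
    (hs : HasCompactSupport v ∨ HasCompactSupport φ) (e : ℂ) :
    ∫ z, v z * fderiv ℝ φ z e = - ∫ z, fderiv ℝ v z e * φ z := by
  have hv' := continuous_fderiv_apply_const hv e
  have hφ' := continuous_fderiv_apply_const hφ e
  refine integral_mul_fderiv_eq_neg_fderiv_mul_of_integrable ?_ ?_ ?_
    (fun x _ => hv.differentiable (by norm_num) x) (fun x _ => hφ.differentiable (by norm_num) x)
  · exact (hv'.mul hφ.continuous).integrable_of_hasCompactSupport
      (hs.elim (fun h => (hasCompactSupport_fderiv_apply h e).mul_right) fun h => h.mul_left)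
  · exact (hv.continuous.mul hφ').integrable_of_hasCompactSupport
      (hs.elim (fun h => h.mul_right) fun h => (hasCompactSupport_fderiv_apply h e).mul_left)
  · exact (hv.continuous.mul hφ.continuous).integrable_of_hasCompactSupport
      (hs.elim (fun h => h.mul_right) fun h => h.mul_left)

lemma integral_mul_fderiv_fderiv {v φ : ℂ → ℝ} (hv : ContDiff ℝ 2 v) (hφ : ContDiff ℝ 2 φ)
    (hs : HasCompactSupport φ) (e : ℂ) :
    ∫ z, v z * fderiv ℝ (fun w => fderiv ℝ φ w e) z e =
      ∫ z, fderiv ℝ (fun w => fderiv ℝ v w e) z e * φ z := by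
  rw [integral_mul_fderiv_eq_neg (hv.of_le (by norm_num)) (contDiff_fderiv_apply_const hφ e)
      (Or.inr (hasCompactSupport_fderiv_apply hs e)),
    integral_mul_fderiv_eq_neg (contDiff_fderiv_apply_const hv e) (hφ.of_le (by norm_num))
      (Or.inr hs), neg_neg]

/-- **Green's second identity** for a compactly supported function. -/
lemma integral_mul_laplacian {v φ : ℂ → ℝ} (hv : ContDiff ℝ 2 v) (hφ : ContDiff ℝ 2 φ)
    (hs : HasCompactSupport φ) :
    ∫ z, v z * Laplacian.laplacian φ z = ∫ z, Laplacian.laplacian v z * φ z := by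
  have hi : ∀ e : ℂ, Integrable fun z => v z * fderiv ℝ (fun w => fderiv ℝ φ w e) z e := fun e =>
    (hv.continuous.mul (continuous_fderiv_apply_const (contDiff_fderiv_apply_const hφ e) e))
      |>.integrable_of_hasCompactSupport
      (hasCompactSupport_fderiv_apply (hasCompactSupport_fderiv_apply hs e) e).mul_left
  have hi' : ∀ e : ℂ, Integrable fun z => fderiv ℝ (fun w => fderiv ℝ v w e) z e * φ z := fun e =>
    ((continuous_fderiv_apply_const (contDiff_fderiv_apply_const hv e) e).mul hφ.continuous)
      |>.integrable_of_hasCompactSupport hs.mul_left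
  simp only [laplacian_eq_fderiv_fderiv hφ, laplacian_eq_fderiv_fderiv hv, mul_add, add_mul]
  rw [integral_add (hi 1) (hi Complex.I), integral_add (hi' 1) (hi' Complex.I),
    integral_mul_fderiv_fderiv hv hφ hs, integral_mul_fderiv_fderiv hv hφ hs]

/-! ### The Laplacian of the Fubini–Study potential of a holomorphic function -/

lemma contDiff_fubiniPotential_comp {f : ℂ → ℂ} (hf : Differentiable ℂ f) :
    ContDiff ℝ ((⊤ : ℕ∞) : WithTop ℕ∞) fun z => fubiniPotential (f z) := by
  have h1 : ContDiff ℝ ((⊤ : ℕ∞) : WithTop ℕ∞) f := hf.contDiff.restrict_scalars ℝ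
  exact contDiff_const.mul ((contDiff_const.add (h1.norm_sq ℝ)).log fun z => by positivity)

lemma hasFDerivAt_real {f : ℂ → ℂ} (hf : Differentiable ℂ f) (z : ℂ) :
    HasFDerivAt f ((ContinuousLinearMap.toSpanSingleton ℂ (deriv f z)).restrictScalars ℝ) z :=
  (hf z).hasDerivAt.hasFDerivAt.restrictScalars ℝ

lemma fderiv_fubiniPotential_comp {f : ℂ → ℂ} (hf : Differentiable ℂ f) (z e : ℂ) :
    fderiv ℝ (fun w => fubiniPotential (f w)) z e =
      inner ℝ (f z) (e * deriv f z) / (1 + ‖f z‖ ^ 2) := by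
  have h1 := (((hasFDerivAt_real hf z).norm_sq.const_add 1).log (by positivity)).const_mul (1 / 2)
  have h2 : (fun w => fubiniPotential (f w)) = fun w => 1 / 2 * Real.log (1 + ‖f w‖ ^ 2) := rfl
  rw [h2, h1.fderiv]
  simp
  ring

lemma fderiv_fderiv_fubiniPotential_comp {f : ℂ → ℂ} (hf : Differentiable ℂ f) (z e : ℂ) :
    fderiv ℝ (fun w => fderiv ℝ (fun w => fubiniPotential (f w)) w e) z e =
      (inner ℝ (e * deriv f z) (e * deriv f z) + inner ℝ (f z) (e * (e * deriv (deriv f) z))) /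
        (1 + ‖f z‖ ^ 2) - 2 * inner ℝ (f z) (e * deriv f z) ^ 2 / (1 + ‖f z‖ ^ 2) ^ 2 := by
  simp only [fderiv_fubiniPotential_comp hf]
  have hf' : Differentiable ℂ (deriv f) := hf.deriv
  have h0 : 1 + ‖f z‖ ^ 2 ≠ 0 := by positivity
  have h1 := ((hasFDerivAt_real hf z).inner ℝ ((hasFDerivAt_real hf' z).const_mul e)).mul
    ((hasDerivAt_inv h0).comp_hasFDerivAt z ((hasFDerivAt_real hf z).norm_sq.const_add 1))
  simp only [div_eq_mul_inv]
  erw [h1.fderiv]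
  simp
  field_simp
  ring

/-- Summed over the directions `1` and `I`, the `f''` terms cancel since `I² = -1`, and the squared
inner products add up to `|f|²|f'|²`. The result is visibly nonnegative. -/
lemma laplacian_fubiniPotential_comp {f : ℂ → ℂ} (hf : Differentiable ℂ f) (z : ℂ) :
    Laplacian.laplacian (fun w => fubiniPotential (f w)) z =
      2 * ‖deriv f z‖ ^ 2 / (1 + ‖f z‖ ^ 2) ^ 2 := by
  rw [laplacian_eq_fderiv_fderiv
      ((contDiff_fubiniPotential_comp hf).of_le (by norm_cast)),
    fderiv_fderiv_fubiniPotential_comp hf, fderiv_fderiv_fubiniPotential_comp hf]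
  have h : 1 + ‖f z‖ ^ 2 ≠ 0 := by positivity
  rw [← mul_assoc Complex.I Complex.I, Complex.I_mul_I]
  field_simp
  rw [← Complex.normSq_eq_norm_sq, ← Complex.normSq_eq_norm_sq]
  simp only [Complex.inner, Complex.normSq_apply, Complex.mul_re, Complex.mul_im, Complex.I_re,
    Complex.I_im, Complex.neg_re, Complex.neg_im, Complex.conj_re,
    Complex.conj_im]
  ring

/-! ### Test functions and measures on the plane -/

/-- Test functions on the plane: smooth with compact support. -/
structure IsTestFunction (φ : ℂ → ℝ) : Prop where
  contDiff : ContDiff ℝ ((⊤ : ℕ∞) : WithTop ℕ∞) φ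
  hasCompactSupport : HasCompactSupport φ

lemma IsTestFunction.contDiff_two {φ : ℂ → ℝ} (h : IsTestFunction φ) : ContDiff ℝ 2 φ :=
  h.contDiff.of_le (by norm_cast)

/-- A test function equal to `1` on the closed disc of radius `r`. -/
lemma exists_isTestFunction_eq_one (r : ℝ) : ∃ χ : ℂ → ℝ, IsTestFunction χ ∧ (∀ z, 0 ≤ χ z) ∧
    (∀ z, χ z ≤ 1) ∧ ∀ z ∈ Metric.closedBall (0 : ℂ) r, χ z = 1 := by
  let b : ContDiffBump (0 : ℂ) := ⟨|r| + 1, |r| + 2, by positivity, by linarith⟩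
  refine ⟨b, ⟨b.contDiff, b.hasCompactSupport⟩, fun z => b.nonneg, fun z => b.le_one, fun z hz => ?_⟩
  refine b.one_of_mem_closedBall (Metric.closedBall_subset_closedBall ?_ hz)
  show r ≤ |r| + 1
  linarith [le_abs_self r]

/-- Uniform approximation of compactly supported continuous functions by test functions. -/
lemma exists_isTestFunction_abs_sub_le {φ : ℂ → ℝ} (hc : Continuous φ) (hs : HasCompactSupport φ) :
    ∃ χ : ℂ → ℝ, IsTestFunction χ ∧ (∀ z, 0 ≤ χ z) ∧ ∀ ε > 0, ∃ ψ, IsTestFunction ψ ∧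
      ∀ z, |φ z - ψ z| ≤ ε * χ z := by
  obtain ⟨r, hr⟩ := hs.isBounded.subset_closedBall 0
  obtain ⟨χ, hχ, h0, -, h1⟩ := exists_isTestFunction_eq_one (r + 1)
  -- The weight `χ` is fixed before `ε`, so one bound on its integrals serves every precision.
  refine ⟨χ, hχ, h0, fun ε hε => ?_⟩
  obtain ⟨δ, hδ, hu⟩ := Metric.uniformContinuous_iff.1
    (hc.uniformContinuous_of_tendsto_cocompact hs.is_zero_at_infty) ε hε
  -- The cap `1` keeps `ψ` supported in the disc of radius `r + 1`, where `χ = 1`.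
  have hδ1 : 0 < min δ 1 := lt_min hδ one_pos
  obtain ⟨ψ, hψ, happ⟩ := hc.exists_contDiff_dist_le_of_forall_mem_ball_dist_le hδ1
  have hzero : ∀ z ∉ Metric.closedBall (0 : ℂ) r, φ z = 0 := fun z hz =>
    image_eq_zero_of_notMem_tsupport fun h => hz (hr h)
  have hout : ∀ z ∉ Metric.closedBall (0 : ℂ) (r + 1), ψ z = 0 := by
    intro z hz
    have hz' : r + 1 < ‖z‖ := by simpa using hz
    have hφz : φ z = 0 := hzero z (by simp; linarith)
    -- Tolerance `0`: `φ` vanishes on the whole averaging ball, so `ψ z = φ z` exactly.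
    have := happ z 0 fun x hx => by
      have hxz : ‖x - z‖ < 1 := by
        rw [← dist_eq_norm]; exact (Metric.mem_ball.1 hx).trans_le (min_le_right _ _)
      have hn := norm_sub_norm_le z x
      rw [norm_sub_rev] at hn
      rw [hφz, hzero x (by simp; linarith), dist_self]
    rw [hφz, dist_zero_right, norm_le_zero_iff] at this
    exact this
  refine ⟨ψ, ⟨hψ, HasCompactSupport.intro (isCompact_closedBall 0 (r + 1)) hout⟩, fun z => ?_⟩
  by_cases hz : z ∈ Metric.closedBall (0 : ℂ) (r + 1)
  · rw [h1 z hz, mul_one, abs_sub_comm, ← Real.dist_eq]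
    exact happ z ε fun x hx => (hu ((Metric.mem_ball.1 hx).trans_le (min_le_left _ _))).le
  · have hz' : z ∉ Metric.closedBall (0 : ℂ) r := fun h =>
      hz (Metric.closedBall_subset_closedBall (by linarith) h)
    rw [hout z hz, hzero z hz', sub_zero, abs_zero]
    exact mul_nonneg hε.le (h0 z)

/-- A bounded open set is the limit of test functions supported in its closure. -/
lemma exists_isTestFunction_tendsto_indicator {U : Set ℂ} (hU : IsOpen U)
    (hb : Bornology.IsBounded U) : ∃ φ : ℕ → ℂ → ℝ, (∀ k, IsTestFunction (φ k)) ∧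
      (∀ k, tsupport (φ k) ⊆ closure U) ∧ ∀ (ν : Measure ℂ) [IsLocallyFiniteMeasure ν],
        Tendsto (fun k => ∫ z, φ k z ∂ν) atTop (𝓝 (ν.real U)) := by
  obtain ⟨f, hfs, hfc, hfr⟩ := hU.exists_contDiff_support_eq (n := (⊤ : ℕ∞))
  have hf01 : ∀ z, 0 ≤ f z ∧ f z ≤ 1 := fun z => hfr (mem_range_self z)
  have hfz : ∀ z ∉ U, f z = 0 := fun z hz => by rwa [← hfs, Function.notMem_support] at hz
  have hsupp : ∀ k : ℕ, tsupport (fun z => 1 - (1 - f z) ^ k) ⊆ closure U := fun k =>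
    closure_mono fun z hz => by
      by_contra h
      exact hz (by simp [hfz z h])
  have hcl : IsCompact (closure U) := hb.isCompact_closure
  -- With `f` smooth, `[0,1]`-valued and nonzero exactly on `U`, these functions increase to the
  -- indicator of `U`, independently of the measure.
  refine ⟨fun k z => 1 - (1 - f z) ^ k, fun k =>
    ⟨contDiff_const.sub ((contDiff_const.sub hfc).pow k), hcl.of_isClosed_subset
      (isClosed_tsupport _) (hsupp k)⟩, hsupp, fun ν _ => ?_⟩
  rw [← integral_indicator_one hU.measurableSet]
  refine tendsto_integral_of_dominated_convergence ((closure U).indicator fun _ => (1 : ℝ))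
    (fun k => (continuous_const.sub ((continuous_const.sub hfc.continuous).pow k))
      |>.aestronglyMeasurable)
    ((integrable_indicator_iff hcl.measurableSet).2
      (integrableOn_const (hs := hcl.measure_lt_top.ne)))
    (fun k => ae_of_all _ fun z => ?_) (ae_of_all _ fun z => ?_)
  · obtain ⟨h0, h1⟩ := hf01 z
    by_cases hz : z ∈ closure U
    · rw [indicator_of_mem hz, Real.norm_eq_abs, abs_le]
      have h2 : (1 - f z) ^ k ≤ 1 := pow_le_one₀ (by linarith) (by linarith)
      have h3 : 0 ≤ (1 - f z) ^ k := pow_nonneg (by linarith) k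
      constructor <;> linarith
    · rw [indicator_of_notMem hz, hfz z fun h => hz (subset_closure h)]
      simp
  · by_cases hz : z ∈ U
    · rw [indicator_of_mem hz]
      have h0 : 0 < f z := lt_of_le_of_ne (hf01 z).1 (Ne.symm (by rwa [← hfs] at hz))
      have := (tendsto_pow_atTop_nhds_zero_of_lt_one (r := 1 - f z) (by linarith [(hf01 z).2])
        (by linarith)).const_sub 1
      simpa using this
    · rw [indicator_of_notMem hz, hfz z hz]
      simp

lemma measurableSpace_eq_generateFrom_bounded_open :
    (inferInstance : MeasurableSpace ℂ) =
      MeasurableSpace.generateFrom {U : Set ℂ | IsOpen U ∧ Bornology.IsBounded U} := by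
  rw [BorelSpace.measurable_eq (α := ℂ)]
  refine TopologicalSpace.IsTopologicalBasis.borel_eq_generateFrom
    (TopologicalSpace.isTopologicalBasis_of_isOpen_of_nhds (fun U hU => hU.1) fun z U hz hU => ?_)
  obtain ⟨r, hr, h⟩ := Metric.isOpen_iff.1 hU z hz
  exact ⟨_, ⟨Metric.isOpen_ball, Metric.isBounded_ball⟩, Metric.mem_ball_self hr, h⟩

lemma isPiSystem_bounded_open :
    IsPiSystem {U : Set ℂ | IsOpen U ∧ Bornology.IsBounded U} :=
  fun _ hU _ hV _ => ⟨hU.1.inter hV.1, hU.2.subset inter_subset_left⟩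

/-- A locally finite measure on the plane is determined by the integrals of test functions. -/
lemma ext_of_integral_isTestFunction {μ ν : Measure ℂ} [IsLocallyFiniteMeasure μ]
    [IsLocallyFiniteMeasure ν] (h : ∀ φ, IsTestFunction φ → ∫ z, φ z ∂μ = ∫ z, φ z ∂ν) :
    μ = ν := by
  refine Measure.ext_of_generateFrom_of_iUnion _ (fun n : ℕ => Metric.ball (0 : ℂ) n)
    measurableSpace_eq_generateFrom_bounded_open isPiSystem_bounded_open
    (Metric.iUnion_ball_nat 0) (fun n => ⟨Metric.isOpen_ball, Metric.isBounded_ball⟩)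
    (fun n => Metric.isBounded_ball.measure_lt_top.ne) fun U hU => ?_
  obtain ⟨φ, hφ, -, ht⟩ := exists_isTestFunction_tendsto_indicator hU.1 hU.2
  have h1 := ht μ
  simp only [fun k => h _ (hφ k)] at h1
  exact (measureReal_eq_measureReal_iff hU.2.measure_lt_top.ne hU.2.measure_lt_top.ne).1
    (tendsto_nhds_unique h1 (ht ν))

/-- A family of probability measures is measurable if the integrals of test functions are. -/
lemma measurable_of_integral_isTestFunction {Ω : Type*} [MeasurableSpace Ω] {μ : Ω → Measure ℂ}
    [∀ ω, IsProbabilityMeasure (μ ω)]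
    (h : ∀ φ, IsTestFunction φ → Measurable fun ω => ∫ z, φ z ∂μ ω) : Measurable μ := by
  refine Measurable.measure_of_isPiSystem_of_isProbabilityMeasure
    measurableSpace_eq_generateFrom_bounded_open isPiSystem_bounded_open fun U hU => ?_
  obtain ⟨φ, hφ, -, ht⟩ := exists_isTestFunction_tendsto_indicator hU.1 hU.2
  have h1 : Measurable fun ω => (μ ω).real U :=
    measurable_of_tendsto_metrizable (fun k => h _ (hφ k)) (tendsto_pi_nhds.2 fun ω => ht (μ ω))
  have h2 : (fun ω => μ ω U) = fun ω => ENNReal.ofReal ((μ ω).real U) :=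
    funext fun ω => (ofReal_measureReal (by finiteness)).symm
  rw [h2]
  exact h1.ennreal_ofReal

/-- A set is null if locally all test functions have integral `0`. -/
lemma measure_eq_zero_of_integral_isTestFunction {μ : Measure ℂ} [IsLocallyFiniteMeasure μ]
    {U : Set ℂ} (h : ∀ z ∈ U, ∃ V ∈ 𝓝 z, ∀ φ, IsTestFunction φ → tsupport φ ⊆ V →
      ∫ w, φ w ∂μ = 0) : μ U = 0 := by
  refine measure_null_of_locally_null U fun z hz => ?_
  obtain ⟨V, hV, hint⟩ := h z hz
  obtain ⟨r, hr, hball⟩ := Metric.nhds_basis_closedBall.mem_iff.1 hV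
  refine ⟨Metric.ball z r, mem_nhdsWithin_of_mem_nhds (Metric.ball_mem_nhds z hr), ?_⟩
  obtain ⟨φ, hφ, hs, ht⟩ := exists_isTestFunction_tendsto_indicator
    (Metric.isOpen_ball (x := z) (ε := r)) Metric.isBounded_ball
  have h1 := ht μ
  simp only [fun k => hint _ (hφ k)
    (((hs k).trans Metric.closure_ball_subset_closedBall).trans hball)] at h1
  have h2 := tendsto_nhds_unique h1 tendsto_const_nhds
  exact (measureReal_eq_zero_iff Metric.isBounded_ball.measure_lt_top.ne).1 h2

/-- If the integrals of every test function against the densities `d n ≥ 0` converge, then so do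
those of every compactly supported continuous function. -/
lemma exists_tendsto_integral_mul_of_isTestFunction {d : ℕ → ℂ → ℝ} (hd : ∀ n, Continuous (d n))
    (hd0 : ∀ n z, 0 ≤ d n z)
    (h : ∀ φ, IsTestFunction φ → ∃ l, Tendsto (fun n => ∫ z, φ z * d n z) atTop (𝓝 l))
    {φ : ℂ → ℝ} (hc : Continuous φ) (hs : HasCompactSupport φ) :
    ∃ l, Tendsto (fun n => ∫ z, φ z * d n z) atTop (𝓝 l) := by
  obtain ⟨χ, hχ, hχ0, happ⟩ := exists_isTestFunction_abs_sub_le hc hs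
  obtain ⟨m, hm⟩ := h χ hχ
  -- Convergence against `χ` bounds its integrals uniformly in `n`; this controls the error of
  -- replacing `φ` by `ψ`.
  obtain ⟨M, hM⟩ := hm.bddAbove_range
  have hM' : ∀ n, ∫ z, χ z * d n z ≤ M := fun n => hM (mem_range_self n)
  have hint : ∀ (ψ : ℂ → ℝ) n, Continuous ψ → HasCompactSupport ψ →
      Integrable fun z => ψ z * d n z := fun ψ n h1 h2 =>
    (h1.mul (hd n)).integrable_of_hasCompactSupport h2.mul_right
  have hM0 : 0 ≤ M := (integral_nonneg fun z => mul_nonneg (hχ0 z) (hd0 0 z)).trans (hM' 0)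
  refine cauchySeq_tendsto_of_complete (Metric.cauchySeq_iff.2 fun ε hε => ?_)
  have hδ : 0 < ε / (4 * (M + 1)) := by positivity
  obtain ⟨ψ, hψ, hψa⟩ := happ _ hδ
  have hest : ∀ n, |(∫ z, φ z * d n z) - ∫ z, ψ z * d n z| ≤ ε / 4 := by
    intro n
    rw [← integral_sub (hint _ n hc hs) (hint _ n hψ.contDiff.continuous hψ.hasCompactSupport)]
    calc |∫ z, (φ z * d n z - ψ z * d n z)| ≤ ∫ z, |φ z * d n z - ψ z * d n z| :=
          abs_integral_le_integral_abs
      _ ≤ ∫ z, ε / (4 * (M + 1)) * (χ z * d n z) := by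
          refine integral_mono_of_nonneg (ae_of_all _ fun z => abs_nonneg _)
            ((hint _ n hχ.contDiff.continuous hχ.hasCompactSupport).const_mul _)
            (ae_of_all _ fun z => ?_)
          show |φ z * d n z - ψ z * d n z| ≤ ε / (4 * (M + 1)) * (χ z * d n z)
          rw [← sub_mul, abs_mul, abs_of_nonneg (hd0 n z), ← mul_assoc]
          exact mul_le_mul_of_nonneg_right (hψa z) (hd0 n z)
      _ = ε / (4 * (M + 1)) * ∫ z, χ z * d n z := integral_const_mul _ _
      _ ≤ ε / (4 * (M + 1)) * (M + 1) := by gcongr; linarith [hM' n]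
      _ = ε / 4 := by field_simp
  obtain ⟨l, hl⟩ := h ψ hψ
  obtain ⟨N, hN⟩ := Metric.cauchySeq_iff.1 hl.cauchySeq (ε / 4) (by positivity)
  refine ⟨N, fun m hm n hn => ?_⟩
  have h1 := abs_le.1 (hest m)
  have h2 := abs_le.1 (hest n)
  have h3 := hN m hm n hn
  rw [Real.dist_eq, abs_lt] at *
  constructor <;> linarith [h3.1, h3.2, h1.1, h1.2, h2.1, h2.2]

open scoped CompactlySupported in
/-- A sequence of absolutely continuous measures that converges on test functions converges to a
locally finite measure. -/
lemma exists_measure_tendsto_integral_mul {d : ℕ → ℂ → ℝ} (hd : ∀ n, Continuous (d n))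
    (hd0 : ∀ n z, 0 ≤ d n z)
    (h : ∀ φ, IsTestFunction φ → ∃ l, Tendsto (fun n => ∫ z, φ z * d n z) atTop (𝓝 l)) :
    ∃ μ : Measure ℂ, IsLocallyFiniteMeasure μ ∧ ∀ φ, IsTestFunction φ →
      Tendsto (fun n => ∫ z, φ z * d n z) atTop (𝓝 (∫ z, φ z ∂μ)) := by
  have hex : ∀ f : C_c(ℂ, ℝ), ∃ l, Tendsto (fun n => ∫ z, f z * d n z) atTop (𝓝 l) := fun f =>
    exists_tendsto_integral_mul_of_isTestFunction hd hd0 h f.continuous f.hasCompactSupport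
  have hint : ∀ (f : C_c(ℂ, ℝ)) n, Integrable fun z => f z * d n z := fun f n =>
    (f.continuous.mul (hd n)).integrable_of_hasCompactSupport f.hasCompactSupport.mul_right
  choose L hL using hex
  let Λ : C_c(ℂ, ℝ) →ₚ[ℝ] ℝ :=
    { toFun := L
      map_add' := fun f g => by
        refine tendsto_nhds_unique (hL (f + g)) (((hL f).add (hL g)).congr fun n => ?_)
        rw [← integral_add (hint f n) (hint g n)]
        simp [add_mul]
      map_smul' := fun c f => by
        refine tendsto_nhds_unique (hL (c • f)) (((hL f).const_mul c).congr fun n => ?_)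
        rw [← integral_const_mul]
        simp [mul_assoc]
      monotone' := fun f g hfg => le_of_tendsto_of_tendsto' (hL f) (hL g) fun n =>
        integral_mono (hint f n) (hint g n) fun z =>
          mul_le_mul_of_nonneg_right (hfg z) (hd0 n z) }
  refine ⟨RealRMK.rieszMeasure Λ, inferInstance, fun φ hφ => ?_⟩
  have h1 := RealRMK.integral_rieszMeasure Λ ⟨⟨φ, hφ.contDiff.continuous⟩, hφ.hasCompactSupport⟩
  have h2 := hL ⟨⟨φ, hφ.contDiff.continuous⟩, hφ.hasCompactSupport⟩
  exact h1 ▸ h2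

/-! ### The total mass of the Laplacian of a function with a logarithmic pole -/

/-- In polar coordinates the radial integrand `2x/(1 + x²)²` has primitive `-1/(1 + x²)`. -/
lemma integral_two_div_one_add_norm_sq_sq :
    ∫ z : ℂ, 2 / (1 + ‖z‖ ^ 2) ^ 2 = 2 * Real.pi := by
  have h := integral_fun_norm_addHaar (volume : Measure ℂ) fun y : ℝ => 2 / (1 + y ^ 2) ^ 2
  rw [h]
  have hd : ∀ x ∈ Ici (0 : ℝ), HasDerivAt (fun y : ℝ => -(1 + y ^ 2)⁻¹)
      (x ^ (Module.finrank ℝ ℂ - 1) • (2 / (1 + x ^ 2) ^ 2)) x := fun x _ => by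
    have h0 : 1 + x ^ 2 ≠ 0 := by positivity
    refine (((hasDerivAt_pow 2 x).const_add 1).inv h0).neg.congr_deriv ?_
    rw [Complex.finrank_real_complex, smul_eq_mul]
    push_cast
    ring
  have ht : Tendsto (fun y : ℝ => -(1 + y ^ 2)⁻¹) atTop (𝓝 0) := by
    have := (tendsto_inv_atTop_zero.comp (tendsto_atTop_add_const_left atTop (1 : ℝ)
      (tendsto_pow_atTop (two_ne_zero)))).neg
    simpa [Function.comp_def] using this
  rw [integral_Ioi_of_hasDerivAt_of_nonneg' hd (fun x hx => by
    have : (0 : ℝ) < x := hx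
    simp only [smul_eq_mul]
    positivity) ht]
  have hvol : (volume : Measure ℂ).real (Metric.ball 0 1) = Real.pi := by
    simp [Measure.real, Complex.volume_ball]
  rw [hvol]
  simp

lemma integrable_two_div_one_add_norm_sq_sq :
    Integrable fun z : ℂ => 2 / (1 + ‖z‖ ^ 2) ^ 2 :=
  -- A non-integrable function has Bochner integral `0` by convention.
  .of_integral_ne_zero (by rw [integral_two_div_one_add_norm_sq_sq]; positivity)

lemma contDiff_fubiniPotential : ContDiff ℝ 2 fubiniPotential :=
  (contDiff_fubiniPotential_comp differentiable_id).of_le (by norm_cast)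

lemma laplacian_fubiniPotential (z : ℂ) :
    Laplacian.laplacian fubiniPotential z = 2 / (1 + ‖z‖ ^ 2) ^ 2 := by
  have h := laplacian_fubiniPotential_comp differentiable_id z
  simpa using h

lemma IsTestFunction.comp_smul {χ : ℂ → ℝ} (h : IsTestFunction χ) {a : ℝ} (ha : a ≠ 0) :
    IsTestFunction fun z => χ (a • z) :=
  ⟨h.contDiff.comp (contDiff_const_smul a), h.hasCompactSupport.comp_smul ha⟩

lemma laplacian_comp_smul {χ : ℂ → ℝ} (h : ContDiff ℝ 2 χ) (a : ℝ) (z : ℂ) :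
    Laplacian.laplacian (fun z => χ (a • z)) z = a ^ 2 * Laplacian.laplacian χ (a • z) := by
  simp only [InnerProductSpace.laplacian_eq_iteratedFDeriv_complexPlane]
  have := iteratedFDeriv_comp_const_smul (i := 2) a h
  rw [this]
  simp only [_root_.smul_apply, smul_eq_mul]
  ring

/-- In real dimension two the factor `a⁻²` from the Laplacian exactly cancels the factor `a²` from
Lebesgue measure. -/
lemma integral_mul_laplacian_comp_inv_smul {u χ : ℂ → ℝ} (h : ContDiff ℝ 2 χ) {a : ℝ}
    (ha : 0 < a) :
    ∫ z, u z * Laplacian.laplacian (fun z => χ (a⁻¹ • z)) z =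
      ∫ z, u (a • z) * Laplacian.laplacian χ z := by
  have h1 := Measure.integral_comp_inv_smul_of_nonneg (volume : Measure ℂ)
    (fun z => u (a • z) * Laplacian.laplacian χ z) ha.le
  simp only [smul_inv_smul₀ ha.ne', Complex.finrank_real_complex] at h1
  simp only [laplacian_comp_smul h]
  have h2 : ∀ z : ℂ, u z * (a⁻¹ ^ 2 * Laplacian.laplacian χ (a⁻¹ • z)) =
      a⁻¹ ^ 2 * (u z * Laplacian.laplacian χ (a⁻¹ • z)) := fun z => by ring
  simp only [h2]
  rw [integral_const_mul, h1, smul_eq_mul, ← mul_assoc, ← mul_pow, inv_mul_cancel₀ ha.ne', one_pow,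
    one_mul]

lemma tendsto_natCast_add_one_inv_smul (z : ℂ) :
    Tendsto (fun n : ℕ => ((n : ℝ) + 1)⁻¹ • z) atTop (𝓝 0) := by
  have h : Tendsto (fun n : ℕ => ((n : ℝ) + 1)⁻¹) atTop (𝓝 0) :=
    tendsto_inv_atTop_zero.comp (tendsto_atTop_add_const_right _ _ tendsto_natCast_atTop_atTop)
  simpa using h.smul_const z

lemma tendsto_natCast_add_one_smul_cobounded {z : ℂ} (hz : z ≠ 0) :
    Tendsto (fun n : ℕ => ((n : ℝ) + 1) • z) atTop (Bornology.cobounded ℂ) := by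
  rw [← tendsto_norm_atTop_iff_cobounded]
  have h : Tendsto (fun n : ℕ => ((n : ℝ) + 1) * ‖z‖) atTop atTop :=
    (tendsto_atTop_add_const_right _ _ tendsto_natCast_atTop_atTop).atTop_mul_const
      (norm_pos_iff.2 hz)
  refine h.congr fun n => ?_
  rw [norm_smul, Real.norm_eq_abs, abs_of_pos (by positivity)]

/-- If `g - ½ log (1 + |z|²)` is bounded and tends to `0` at infinity, then the distribution
`(1 / 2π) Δ g` has total mass `1`. -/
lemma tendsto_integral_mul_laplacian_comp_inv_smul {g : ℂ → ℝ} (hg : Continuous g) {C : ℝ}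
    (hC : ∀ z, |g z - fubiniPotential z| ≤ C)
    (h0 : Tendsto (fun z => g z - fubiniPotential z) (Bornology.cobounded ℂ) (𝓝 0))
    {χ : ℂ → ℝ} (hχ : IsTestFunction χ) (hχ0 : ∀ z, 0 ≤ χ z) (hχ1 : ∀ z, χ z ≤ 1)
    (h1 : χ 0 = 1) :
    Tendsto (fun n : ℕ => 1 / (2 * Real.pi) *
      ∫ z, g z * Laplacian.laplacian (fun z => χ (((n : ℝ) + 1)⁻¹ • z)) z) atTop (𝓝 1) := by
  have hpos : ∀ n : ℕ, (0 : ℝ) < (n : ℝ) + 1 := fun n => by positivity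
  have hχn : ∀ n : ℕ, IsTestFunction fun z => χ (((n : ℝ) + 1)⁻¹ • z) := fun n =>
    hχ.comp_smul (inv_ne_zero (hpos n).ne')
  have hlap := continuous_laplacian hχ.contDiff_two
  have hlaps := hasCompactSupport_laplacian hχ.hasCompactSupport
  -- With the Laplacian moved onto the potential, the integrand converges to the integrable density
  -- of total integral `2π`.
  have hmain : Tendsto (fun n : ℕ => ∫ z, fubiniPotential z *
      Laplacian.laplacian (fun z => χ (((n : ℝ) + 1)⁻¹ • z)) z) atTop (𝓝 (2 * Real.pi)) := by
    simp only [fun n => integral_mul_laplacian contDiff_fubiniPotential (hχn n).contDiff_two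
      (hχn n).hasCompactSupport, laplacian_fubiniPotential]
    rw [← integral_two_div_one_add_norm_sq_sq]
    refine tendsto_integral_of_dominated_convergence _
      (fun n => (integrable_two_div_one_add_norm_sq_sq.aestronglyMeasurable.mul
        (hχn n).contDiff.continuous.aestronglyMeasurable)) integrable_two_div_one_add_norm_sq_sq
      (fun n => ae_of_all _ fun z => ?_) (ae_of_all _ fun z => ?_)
    · rw [norm_mul, Real.norm_of_nonneg (by positivity : (0 : ℝ) ≤ 2 / (1 + ‖z‖ ^ 2) ^ 2),
        Real.norm_of_nonneg (hχ0 _)]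
      exact mul_le_of_le_one_right (by positivity) (hχ1 _)
    · have h2 := (hχ.contDiff.continuous.tendsto 0).comp (tendsto_natCast_add_one_inv_smul z)
      rw [h1] at h2
      simpa using h2.const_mul (2 / (1 + ‖z‖ ^ 2) ^ 2)
  -- After rescaling, the difference is evaluated at `(n + 1) z`, which goes to infinity for `z ≠
  -- 0`, against a fixed compactly supported function.
  have herr : Tendsto (fun n : ℕ => ∫ z, (g z - fubiniPotential z) *
      Laplacian.laplacian (fun z => χ (((n : ℝ) + 1)⁻¹ • z)) z) atTop (𝓝 0) := by
    simp only [fun n : ℕ => integral_mul_laplacian_comp_inv_smul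
      (u := fun z => g z - fubiniPotential z) hχ.contDiff_two (hpos n)]
    rw [← integral_zero ℂ ℝ (μ := volume)]
    refine tendsto_integral_of_dominated_convergence
      (fun z => C * ‖(Laplacian.laplacian χ : ℂ → ℝ) z‖)
      (fun n => ((((hg.sub continuous_fubiniPotential).comp (continuous_const_smul _)).mul hlap)
        |>.aestronglyMeasurable))
      ((hlap.integrable_of_hasCompactSupport hlaps).norm.const_mul C)
      (fun n => ae_of_all _ fun z => ?_) ?_
    · rw [norm_mul]
      exact mul_le_mul_of_nonneg_right (hC _) (norm_nonneg _)
    · filter_upwards [compl_mem_ae_iff.2 (measure_singleton (0 : ℂ))] with z hz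
      simpa using (h0.comp (tendsto_natCast_add_one_smul_cobounded hz)).mul_const
        (Laplacian.laplacian χ z)
  have hsum := (hmain.add herr).const_mul (1 / (2 * Real.pi))
  rw [add_zero, one_div_mul_cancel (by positivity)] at hsum
  refine hsum.congr fun n => ?_
  have hl := continuous_laplacian (hχn n).contDiff_two
  have hls := hasCompactSupport_laplacian (hχn n).hasCompactSupport
  rw [← integral_add]
  · congr 2
    funext z
    ring
  · exact (continuous_fubiniPotential.mul hl).integrable_of_hasCompactSupport hls.mul_left
  · exact ((hg.sub continuous_fubiniPotential).mul hl).integrable_of_hasCompactSupport hls.mul_left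

/-- Harmonic functions have vanishing distributional Laplacian. -/
lemma integral_mul_laplacian_eq_zero_of_harmonicOnNhd {g : ℂ → ℝ} {z : ℂ} {r : ℝ} (hr : 0 < r)
    (hg : InnerProductSpace.HarmonicOnNhd g (Metric.closedBall z (2 * r))) {φ : ℂ → ℝ}
    (hφ : IsTestFunction φ) (hs : tsupport φ ⊆ Metric.ball z r) :
    ∫ w, g w * Laplacian.laplacian φ w = 0 := by
  -- Cutting off makes `b g` a `C²` function on the whole plane without changing `g` near the
  -- support of `φ`, so Green's identity applies.
  let b : ContDiffBump z := ⟨r, 2 * r, hr, by linarith⟩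
  have hv : ContDiff ℝ 2 fun w => b w * g w := by
    rw [contDiff_iff_contDiffAt]
    intro w
    by_cases hw : w ∈ Metric.closedBall z (2 * r)
    · exact b.contDiff.contDiffAt.mul (hg w hw).1
    · have hw' : w ∉ tsupport b := by rwa [b.tsupport_eq]
      refine contDiffAt_const (c := (0 : ℝ)) |>.congr_of_eventuallyEq ?_
      filter_upwards [notMem_tsupport_iff_eventuallyEq.1 hw'] with x hx
      rw [hx, Pi.zero_apply, zero_mul]
  have hone : ∀ w ∈ Metric.ball z r, b w = 1 := fun w hw =>
    b.one_of_mem_closedBall (Metric.ball_subset_closedBall hw)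
  have h1 : ∀ w, g w * Laplacian.laplacian φ w = (b w * g w) * Laplacian.laplacian φ w := by
    intro w
    by_cases hw : w ∈ tsupport φ
    · rw [hone w (hs hw), one_mul]
    · rw [laplacian_eq_zero_of_notMem_tsupport hw, mul_zero, mul_zero]
  simp only [h1]
  rw [integral_mul_laplacian hv hφ.contDiff_two hφ.hasCompactSupport]
  refine integral_eq_zero_of_ae (ae_of_all _ fun w => ?_)
  show Laplacian.laplacian (fun w => b w * g w) w * φ w = 0
  by_cases hw : w ∈ tsupport φ
  · have he : (fun w => b w * g w) =ᶠ[𝓝 w] g := by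
      filter_upwards [Metric.isOpen_ball.mem_nhds (hs hw)] with x hx
      rw [hone x hx, one_mul]
    have hw' : w ∈ Metric.closedBall z (2 * r) :=
      Metric.ball_subset_closedBall (Metric.ball_subset_ball (by linarith) (hs hw))
    have hlap : Laplacian.laplacian (fun w => b w * g w) w = 0 := by
      rw [(InnerProductSpace.laplacian_congr_nhds he).self_of_nhds]
      exact (hg w hw').2.self_of_nhds
    rw [hlap, zero_mul]
  · rw [image_eq_zero_of_notMem_tsupport hw, mul_zero]

namespace BoundedRandomQuadraticSystem

variable {Ω : Type*} [MeasurableSpace Ω] {P : Measure Ω} (S : BoundedRandomQuadraticSystem P)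

/-! ### The equilibrium measures -/

lemma smoothGreen_eq_smul (ω : Ω) (n : ℕ) :
    S.smoothGreen ω n = (1 / 2 ^ n : ℝ) • fun z => fubiniPotential (S.iter ω n z) := by
  funext z
  simp [smoothGreen, div_eq_inv_mul]

lemma contDiff_smoothGreen (ω : Ω) (n : ℕ) : ContDiff ℝ 2 (S.smoothGreen ω n) := by
  rw [smoothGreen_eq_smul]
  exact contDiff_const.smul
    ((contDiff_fubiniPotential_comp (S.differentiable_iter ω n)).of_le (by norm_cast))

lemma laplacian_smoothGreen_nonneg (ω : Ω) (n : ℕ) (z : ℂ) :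
    0 ≤ Laplacian.laplacian (S.smoothGreen ω n) z := by
  have h := (contDiff_fubiniPotential_comp (S.differentiable_iter ω n)).of_le
    (m := 2) (by norm_cast)
  rw [smoothGreen_eq_smul, InnerProductSpace.laplacian_smul _ h.contDiffAt,
    laplacian_fubiniPotential_comp (S.differentiable_iter ω n), smul_eq_mul]
  positivity

lemma tendsto_integral_smoothGreen_mul_laplacian (ω : Ω) {φ : ℂ → ℝ} (hφ : IsTestFunction φ) :
    Tendsto (fun n => ∫ z, S.smoothGreen ω n z * Laplacian.laplacian φ z) atTop
      (𝓝 (∫ z, S.green ω z * Laplacian.laplacian φ z)) := by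
  have hl := continuous_laplacian hφ.contDiff_two
  have hls := hasCompactSupport_laplacian hφ.hasCompactSupport
  refine tendsto_integral_of_dominated_convergence
    (fun z => (|S.green ω z| + potentialDefectBound S.R) * |(Laplacian.laplacian φ : ℂ → ℝ) z|)
    (fun n => ((S.continuous_smoothGreen ω n).mul hl).aestronglyMeasurable)
    ((((S.continuous_green ω).abs.add continuous_const).mul hl.abs)
      |>.integrable_of_hasCompactSupport (hls.abs).mul_left)
    (fun n => ae_of_all _ fun z => ?_)
    (ae_of_all _ fun z => (S.tendsto_smoothGreen ω z).mul_const _)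
  rw [norm_mul, Real.norm_eq_abs, Real.norm_eq_abs]
  refine mul_le_mul_of_nonneg_right ?_ (abs_nonneg _)
  have h1 := S.dist_smoothGreen_green_le ω n z
  rw [Real.dist_eq] at h1
  have h2 : potentialDefectBound S.R / 2 ^ n ≤ potentialDefectBound S.R :=
    div_le_self (potentialDefectBound_nonneg _) (one_le_pow₀ (by norm_num))
  have h3 := abs_sub_abs_le_abs_sub (S.smoothGreen ω n z) (S.green ω z)
  linarith

/-- The nonnegative densities `(1/2π) Δ(2⁻ⁿ N(fⁿ))` converge on test functions once the Laplacian is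
moved onto `φ`. -/
lemma exists_measure_integral_eq_green (ω : Ω) : ∃ μ : Measure ℂ, IsLocallyFiniteMeasure μ ∧
    ∀ φ, IsTestFunction φ →
      ∫ z, φ z ∂μ = 1 / (2 * Real.pi) * ∫ z, S.green ω z * Laplacian.laplacian φ z := by
  have hconv : ∀ φ, IsTestFunction φ → Tendsto (fun n => ∫ z, φ z *
      (1 / (2 * Real.pi) * Laplacian.laplacian (S.smoothGreen ω n) z)) atTop
      (𝓝 (1 / (2 * Real.pi) * ∫ z, S.green ω z * Laplacian.laplacian φ z)) := by
    intro φ hφ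
    refine ((S.tendsto_integral_smoothGreen_mul_laplacian ω hφ).const_mul
      (1 / (2 * Real.pi))).congr fun n => ?_
    rw [integral_mul_laplacian (S.contDiff_smoothGreen ω n) hφ.contDiff_two hφ.hasCompactSupport,
      ← integral_const_mul]
    congr 1
    funext z
    ring
  obtain ⟨μ, hμ, h⟩ := exists_measure_tendsto_integral_mul
    (fun n => continuous_const.mul (continuous_laplacian (S.contDiff_smoothGreen ω n)))
    (fun n z => mul_nonneg (by positivity) (S.laplacian_smoothGreen_nonneg ω n z))
    (fun φ hφ => ⟨_, hconv φ hφ⟩)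
  exact ⟨μ, hμ, fun φ hφ => tendsto_nhds_unique (h φ hφ) (hconv φ hφ)⟩

/-- The equilibrium measure `μ_ω = (1 / 2π) Δ g_ω`. -/
noncomputable def equilibriumMeasure (ω : Ω) : Measure ℂ :=
  (S.exists_measure_integral_eq_green ω).choose

instance (ω : Ω) : IsLocallyFiniteMeasure (S.equilibriumMeasure ω) :=
  (S.exists_measure_integral_eq_green ω).choose_spec.1

lemma integral_equilibriumMeasure (ω : Ω) {φ : ℂ → ℝ} (hφ : IsTestFunction φ) :
    ∫ z, φ z ∂S.equilibriumMeasure ω =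
      1 / (2 * Real.pi) * ∫ z, S.green ω z * Laplacian.laplacian φ z :=
  (S.exists_measure_integral_eq_green ω).choose_spec.2 φ hφ

lemma isNormalizedLaplacian_green_iff (ω : Ω) (ν : Measure ℂ) :
    IsNormalizedLaplacian (S.green ω) ν ↔ ν = S.equilibriumMeasure ω := by
  constructor
  · intro h
    have := h.locallyFinite
    refine ext_of_integral_isTestFunction fun φ hφ => ?_
    rw [h.integral_eq φ hφ.contDiff hφ.hasCompactSupport, S.integral_equilibriumMeasure ω hφ]
  · rintro rfl
    exact ⟨(S.continuous_green ω).locallyIntegrable, inferInstance,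
      fun φ h1 h2 => S.integral_equilibriumMeasure ω ⟨h1, h2⟩⟩

/-! ### The equilibrium measure is carried by the Julia set -/

lemma equilibriumMeasure_escapingSet (ω : Ω) :
    S.equilibriumMeasure ω (S.escapingSet ω) = 0 := by
  refine measure_eq_zero_of_integral_isTestFunction fun z hz => ?_
  obtain ⟨r, hr, h⟩ := Metric.nhds_basis_closedBall.mem_iff.1
    ((S.isOpen_escapingSet ω).mem_nhds hz)
  refine ⟨Metric.ball z (r / 2), Metric.ball_mem_nhds z (by positivity), fun φ hφ hs => ?_⟩
  rw [S.integral_equilibriumMeasure ω hφ, integral_mul_laplacian_eq_zero_of_harmonicOnNhd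
    (half_pos hr) ((S.harmonicOnNhd_green ω).mono (by rwa [mul_div_cancel₀ r two_ne_zero])) hφ hs,
    mul_zero]

lemma equilibriumMeasure_interior_filledJulia (ω : Ω) :
    S.equilibriumMeasure ω (interior (S.filledJulia ω)) = 0 := by
  refine measure_eq_zero_of_integral_isTestFunction fun z hz =>
    ⟨_, isOpen_interior.mem_nhds hz, fun φ hφ hs => ?_⟩
  have h0 : ∀ w, S.green ω w * Laplacian.laplacian φ w = 0 := fun w => by
    by_cases hw : w ∈ tsupport φ
    · rw [S.green_of_notMem (interior_subset (hs hw)), zero_mul]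
    · rw [laplacian_eq_zero_of_notMem_tsupport hw, mul_zero]
  simp [S.integral_equilibriumMeasure ω hφ, h0]

/-- A point at which the iterates are normal is in the escaping set or in the interior of the
filled-in Julia set. -/
lemma compl_julia_subset (ω : Ω) :
    (S.julia ω)ᶜ ⊆ S.escapingSet ω ∪ interior (S.filledJulia ω) := by
  intro z hz
  simp only [julia, mem_compl_iff, mem_ofPred_eq, not_forall, not_not] at hz
  obtain ⟨U, hU, hzU, hn⟩ := hz
  let _ : UniformSpace (OnePoint ℂ) := uniformSpaceOfCompactR1
  obtain ⟨t, ht, h, hlim⟩ := hn id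
  have hcont : ContinuousOn h U := hlim.continuousOn
    (Frequently.of_forall fun k => (OnePoint.continuous_coe.comp (S.continuous_iter ω _)).continuousOn)
  have hpt : ∀ w ∈ U, Tendsto (fun k => (S.iter ω (t k) w : OnePoint ℂ)) atTop (𝓝 (h w)) :=
    fun w hw => hlim.tendsto_at hw
  -- If the limit at `z` is `∞`, some iterate passes the escape radius. Otherwise the limit is
  -- finite near `z` by continuity, whereas an escaping point would force the value `∞`; so a
  -- neighbourhood of `z` lies in the filled-in set.
  by_cases hinf : h z = OnePoint.infty
  · left
    have h1 := hpt z hzU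
    rw [hinf, show (fun k => (S.iter ω (t k) z : OnePoint ℂ)) =
      ((↑) : ℂ → OnePoint ℂ) ∘ fun k => S.iter ω (t k) z from rfl, ← tendsto_comap_iff,
      OnePoint.comap_coe_nhds_infty, coclosedCompact_eq_cocompact,
      ← Metric.cobounded_eq_cocompact, ← tendsto_norm_atTop_iff_cobounded] at h1
    obtain ⟨k, hk⟩ := (h1.eventually_ge_atTop (S.R + 2)).exists
    exact S.mem_escapingSet_of_le hk
  · right
    rw [mem_interior_iff_mem_nhds]
    filter_upwards [hU.mem_nhds hzU, (hcont.continuousAt (hU.mem_nhds hzU)).preimage_mem_nhds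
      (isOpen_compl_singleton.mem_nhds hinf)] with w hw hw' hA
    have h1 : Tendsto (fun k => S.iter ω (t k) w) atTop (Bornology.cobounded ℂ) :=
      Tendsto.comp hA ht.tendsto_atTop
    rw [Metric.cobounded_eq_cocompact, ← coclosedCompact_eq_cocompact,
      ← OnePoint.comap_coe_nhds_infty, tendsto_comap_iff] at h1
    exact hw' (tendsto_nhds_unique (hpt w hw) h1)

lemma equilibriumMeasure_compl_julia (ω : Ω) :
    S.equilibriumMeasure ω (S.julia ω)ᶜ = 0 :=
  measure_mono_null (S.compl_julia_subset ω) (measure_union_null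
    (S.equilibriumMeasure_escapingSet ω) (S.equilibriumMeasure_interior_filledJulia ω))

/-! ### Total mass one and measurability in `ω` -/

lemma filledJulia_subset_closedBall (ω : Ω) :
    S.filledJulia ω ⊆ Metric.closedBall 0 (S.R + 2) := fun z hz => by
  simpa using (S.norm_iter_lt hz 0).le

/-- The measure is carried by the disc of radius `R + 2`, where every dilated cutoff is `1`. The
integrals of the cutoffs are therefore constant in `n`, while they tend to `1`. -/
instance isProbabilityMeasure_equilibriumMeasure (ω : Ω) :
    IsProbabilityMeasure (S.equilibriumMeasure ω) := by
  obtain ⟨χ, hχ, h0, h1, hone⟩ := exists_isTestFunction_eq_one (S.R + 2)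
  have hR := S.R_pos
  have hlim := tendsto_integral_mul_laplacian_comp_inv_smul (S.continuous_green ω)
    (S.abs_green_sub_fubiniPotential_le ω) (S.tendsto_green_sub_fubiniPotential ω) hχ h0 h1
    (hone 0 (Metric.mem_closedBall_self (by linarith)))
  have hconst : ∀ n : ℕ, 1 / (2 * Real.pi) * ∫ z, S.green ω z *
      Laplacian.laplacian (fun z => χ (((n : ℝ) + 1)⁻¹ • z)) z =
        (S.equilibriumMeasure ω).real univ := by
    intro n
    have hn : (0 : ℝ) < (n : ℝ) + 1 := by positivity
    rw [← S.integral_equilibriumMeasure ω (hχ.comp_smul (inv_ne_zero hn.ne')),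
      ← integral_indicator_one MeasurableSet.univ]
    refine integral_congr_ae ?_
    filter_upwards [compl_mem_ae_iff.2 (S.equilibriumMeasure_escapingSet ω)] with z hz
    rw [indicator_of_mem (mem_univ z), Pi.one_apply]
    have hz' := S.filledJulia_subset_closedBall ω hz
    refine hone _ ?_
    rw [mem_closedBall_zero_iff] at hz' ⊢
    rw [norm_smul, Real.norm_of_nonneg (inv_nonneg.2 hn.le)]
    refine (mul_le_of_le_one_left (norm_nonneg z) (inv_le_one_of_one_le₀ ?_)).trans hz'
    linarith [(Nat.cast_nonneg n : (0 : ℝ) ≤ n)]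
  simp only [hconst] at hlim
  have h := tendsto_nhds_unique tendsto_const_nhds hlim
  refine ⟨?_⟩
  -- Infinite mass is excluded because its real value would be `0`.
  rw [Measure.real, ENNReal.toReal_eq_one_iff] at h
  exact h

/-- Each measure is chosen separately for its `ω`, but its test integrals are given by a formula in
`g_ω`, measurable in `ω` by Fubini. -/
lemma measurable_equilibriumMeasure : Measurable S.equilibriumMeasure := by
  refine measurable_of_integral_isTestFunction fun φ hφ => ?_
  simp only [fun ω => S.integral_equilibriumMeasure ω hφ]
  have hl := (continuous_laplacian hφ.contDiff_two).measurable
  have hm : Measurable fun p : Ω × ℂ => S.green p.1 p.2 * Laplacian.laplacian φ p.2 :=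
    S.measurable_green.mul (hl.comp measurable_snd)
  exact (hm.stronglyMeasurable.integral_prod_right').measurable.const_mul _

lemma isRandomProbabilityMeasure_equilibriumMeasure :
    IsRandomProbabilityMeasure P S.equilibriumMeasure :=
  ⟨fun _ hB => (Measure.measurable_coe hB).comp S.measurable_equilibriumMeasure,
    ae_of_all _ S.isProbabilityMeasure_equilibriumMeasure⟩

end BoundedRandomQuadraticSystem

/-! ### The main theorem -/

theorem proposition3p1 {Ω : Type*} [MeasurableSpace Ω] (P : Measure Ω)
    [IsProbabilityMeasure P] [P.IsComplete] (S : BoundedRandomQuadraticSystem P) :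
    -- the filled-in Julia sets form a random closed set
    IsRandomClosedSet S.filledJulia ∧
    -- the limit defining the Green function exists
    (∀ ω, ∀ z ∈ S.escapingSet ω,
      Tendsto (fun n : ℕ => 1 / 2 ^ n * Real.log ‖S.iter ω n z‖) atTop (𝓝 (S.green ω z))) ∧
    (∀ ω, IsGreenFunctionAtInfinity (S.escapingSet ω) (S.green ω)) ∧
    -- the Green functions form a random continuous function on every disc
    (∀ R₀ : ℝ, 0 < R₀ →
      IsRandomContinuous P (fun ω (z : Metric.ball (0 : ℂ) R₀) => S.green ω z)) ∧
    -- the equilibrium measures exist, are unique, live on the Julia sets,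
    -- and form a random probability measure
    ∃ μ : Ω → Measure ℂ,
      (∀ ω (ν : Measure ℂ), IsNormalizedLaplacian (S.green ω) ν ↔ ν = μ ω) ∧
      (∀ ω, IsProbabilityMeasure (μ ω) ∧ μ ω (S.julia ω)ᶜ = 0) ∧
      IsRandomProbabilityMeasure P μ :=
  ⟨S.isRandomClosedSet_filledJulia, fun _ _ hz => S.tendsto_log_iter hz,
    S.isGreenFunctionAtInfinity, fun _ hr => S.isRandomContinuous_green hr,
    S.equilibriumMeasure, S.isNormalizedLaplacian_green_iff,
    fun ω => ⟨S.isProbabilityMeasure_equilibriumMeasure ω, S.equilibriumMeasure_compl_julia ω⟩,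
    S.isRandomProbabilityMeasure_equilibriumMeasure⟩
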